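/- **Conventions.** For a payoff $\pi(p,y)$ in a finite-dimensional Euclidean space, a forecast $p$ *solves the half-space problem* in direction $c$ for the ball of radius $\varepsilon\ge 0$ if $\langle c,\pi(p,y)\rangle\le\varepsilon\|c\|$ for all outcomes $y$ (for $\varepsilon=0$: exactly, i.e. $\max_y\langle c,\pi(p,y)\rangle\le 0$). A *half-space oracle* returns such a $p$ for every $c$. A *quantile function* for a set $S\subseteq\mathbb R$ of outcomes is a nondecreasing $Q:[0,1]\to[-\infty,\infty]$ with $Q(0)<y\le Q(1)$ for all $y\in S$. Let $D\subset\mathbb R^d$ be compact and convex, and let $T$ be a finite triangulation of $D$ with vertex set $V$. For $f\in D$ let $w_v(f)$ ($v\in V$) be the barycentric weights of $f$ in its simplex, and for $c\in(\mathbb R^d)^V$ put $\rho_c(f)=f-\sum_v w_v(f)c_v$. A *projected fixed point* of $\rho_c$ is an $f\in D$ that is a nearest point of $D$ to $\rho_c(f)$ (so $\rho_c(f)=f$ whenever $\rho_c(f)\in D$). The *mesh* of $T$ is less than $\varepsilon$ if any two points of a common simplex are at distance less than $\varepsilon$. **Theorem.** There are half-space oracles as follows. 1. *Adaptive conformal inference.*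 Let $\beta\in[0,1]$. (a) Randomized: let $M\ge1$, $0=a_0<\dots<a_M=1$, and $\pi_i(p,y)=p_i(\mathbb 1\{y\le Q(a_i)\}-\beta)$ for probability vectors $p$. For every $c\in\mathbb R^{M+1}$ there is a $p$, supported on two adjacent points $a_i,a_{i+1}$, such that for every quantile function $Q$ for $S$ and every $y\in S$: $\langle c,\pi(p,y)\rangle\le\varepsilon\sum_i|c_i|$ for all $\varepsilon>1/M$ (the half-space condition for the max-norm ball of radius $\varepsilon$); $\langle c,\pi(p,y)\rangle\le\varepsilon\|c\|$ for all $\varepsilon\ge1/\sqrt{M+1}$; and $\langle c,\pi(p,y)\rangle\le0$ if some $c_i=0$, or all $c_i>0$, or all $c_i<0$, or $c_i>0>c_{i+1}$ for some $i$. (b) Deterministic, action set $[0,1]$: for every continuous $c:[0,1]\to\mathbb R$ there is an $a'$, which is a root of $c$, or $0$ if $c>0$, or $1$ if $c<0$, such that $c(a')(\mathbb 1\{y\le Q(a')\}-\beta)\le0$ for every quantile function $Q$ for $S$ and every $y\in S$. 2. *Quantile calibration.* (a) For every integrable $c:[0,1]\to\mathbb R$ there is a $\tau\in[0,1]$ (with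 $\tau\in\{0,1\}$ or $c(\tau)=0$ if $c$ is continuous) such that the recalibrator $R(a)=\mathbb 1\{a\ge\tau\}$ satisfies $\int_0^1c(a)\,(\mathbb 1\{y\le Q(R(a))\}-a)\,da\le0$ for every quantile function $Q$ for $S$ and every $y\in S$. (b) For every finite set $L\subset[0,1]$ of levels, every $c\in\mathbb R^L$ and every interval $[y_{\min},y_{\max}]$ there is a probability distribution $p$ on $\mathbb R$ with continuous CDF $F_p$ and $\sum_{q\in L}c_q(\mathbb 1\{F_p(y)\le q\}-q)\le0$ for all $y\in[y_{\min},y_{\max}]$. 3. *Moment-based calibration.* Let $B>0$, $M\ge1$, $\varepsilon>\sqrt{(2B/M)^2+(B^2/M)^2}$, $D=[-B,B]\times[0,B^2]$, and $\varphi(y)=(y,y^2)$ for $|y|\le B$. There is a triangulation of $D$ of mesh less than $\varepsilon$ whose vertices are the $(M+1)^2$ points of the regular grid. For every finite triangulation of $D$ of mesh less than $\varepsilon$ and every $c\in(\mathbb R^2)^V$ there is a projected fixed point $f$ of $\rho_c$ such that the randomized forecast playing $v$ with probability $w_v(f)$ only plays vertices within $\varepsilon$ of each other and solves the half-space problem in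 direction $c$ for the ball of radius $\varepsilon$ and the payoff $\pi_v(p,y)=p_v\,(v-\varphi(y))$, and such that the deterministic forecast $f$ solves it exactly for the payoff $w_v(f)(f-\varphi(y))$. 4. *Discretized distribution calibration.* Let $B>0$, let $[-B,B]$ be partitioned into $n\ge1$ bins, let $N\ge1$ and $\varepsilon>\sqrt n/N$, let $D$ be the simplex of probability vectors on the bins, and let $\varphi(y)$ be the unit vector of the bin of $y$. There is a triangulation of $D$ of mesh less than $\varepsilon$ whose vertices are the probability vectors with entries in $\frac1N\mathbb Z$; and for every finite triangulation of $D$ of mesh less than $\varepsilon$ the conclusion of part 3 holds with this $D$ and $\varphi$. 5. *Decision calibration.* Let $Y$ be a nonempty compact metric space, $A$ a finite nonempty set of actions, $x$ a context, and $u(a,\cdot,x)$ continuous on $Y$ for every $a\in A$. (a) For every $c\in\mathbb R^A$ some probability measure $p$ on $Y$ solves the half-space problem exactly for the payoff $\pi_a(p,y)=\mathbb E_{y'\sim p}u(a,y',x)-u(a,y,x)$. (b) For every $\varepsilon>0$ there are finitely many outcomes $r_1,\dots,r_n\in Y$ ($n\ge 1$) and $\eta>0$ such that for every finite triangulation of mesh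 less than $\eta$ of the simplex of probability vectors on $\{1,\dots,n\}$ (a vector $v$ being the forecast $p_v=\sum_kv_k\delta_{r_k}$), every Bayes decision rule $\delta$ and every $c\in\mathbb R^{A\times A}$, there is a projected fixed point $f$ of $\rho_{\tilde c}$, where $\tilde c_v=\big(\sum_ac_{a,\delta(p_v,x)}u(a,r_k,x)\big)_k$, for which the randomized forecast playing $p_v$ with probability $w_v(f)$ only plays vertices $v$ within $\varepsilon$ of each other and solves the half-space problem in direction $c$ for the ball of radius $\varepsilon$ and the expected payoff $\sum_vw_v(f)\,\pi(p_v,y)$, where $\pi_{a,a'}(p,y)=\mathbb 1\{a'=\delta(p,x)\}\big(\mathbb E_{y'\sim p}u(a,y',x)-u(a,y,x)\big)$. -/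

import Mathlib

open MeasureTheory

noncomputable section

namespace HalfSpace

/-! ### The half-space problem -/

/-- `p` solves the half-space problem of the payoff `π` in the direction `c` (the average payoff so
far) for the closed ball of radius `ε` around the origin: whatever the outcome `y ∈ S`, the payoff
lies in the half-space `{z | ⟪c, z⟫ ≤ ε ‖c‖}`, the smallest half-space with outer normal `c` that
contains the ball. For `ε = 0` this is `max_y ⟪c, π p y⟫ ≤ 0`. -/
def Solves {P Y H : Type*} [NormedAddCommGroup H] [InnerProductSpace ℝ H]
    (π : P → Y → H) (S : Set Y) (ε : ℝ) (c : H) (p : P) : Prop :=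
  ∀ y ∈ S, inner ℝ c (π p y) ≤ ε * ‖c‖

/-! ### Quantile-based notions -/

/-- `Q` is a (possibly extended-real-valued) quantile function for outcomes in `S`: it is
nondecreasing, and its two end values lie below, respectively not below, every outcome. -/
def IsQuantileFn (Q : unitInterval → EReal) (S : Set ℝ) : Prop :=
  Monotone Q ∧ ∀ y ∈ S, Q 0 < (y : EReal) ∧ (y : EReal) ≤ Q 1

open Classical in
/-- The indicator `e(a) = 𝟙{y ≤ Q(a)}`. -/
def cover (Q : unitInterval → EReal) (y : ℝ) (a : unitInterval) : ℝ :=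
  if (y : EReal) ≤ Q a then 1 else 0

/-- The payoff of adaptive conformal inference with target level `β` on a finite action set
`a 0, …, a M`: the entry of the action `a i` is `p i * (𝟙{y ≤ Q (a i)} - β)`. -/
def aciPayoff {M : ℕ} (Q : unitInterval → EReal) (β : ℝ) (a : Fin (M + 1) → unitInterval)
    (p : Fin (M + 1) → ℝ) (y : ℝ) : EuclideanSpace ℝ (Fin (M + 1)) :=
  WithLp.toLp 2 fun i => p i * (cover Q y (a i) - β)

/-- The recalibrator that jumps from level `0` to level `1` at `τ`. -/
def stepRecal (τ a : unitInterval) : unitInterval := if a < τ then 0 else 1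

open Classical in
/-- The quantile calibration payoff `𝟙{F_p(y) ≤ q} - q` indexed by a finite set of levels `q`,
where `F_p` is the cumulative distribution function of the forecast `p`. -/
def quantilePayoff (L : Finset ℝ) (p : Measure ℝ) (y : ℝ) : EuclideanSpace ℝ L :=
  WithLp.toLp 2 fun q => (if ProbabilityTheory.cdf p y ≤ (q : ℝ) then 1 else 0) - (q : ℝ)

/-! ### Triangulations, test functions and fixed points -/

section Triangulation

variable {E : Type*} [NormedAddCommGroup E] [InnerProductSpace ℝ E]

/-- Any two points of a common simplex of `T` are at distance less than `ε`. -/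
def MeshLT (T : Geometry.SimplicialComplex ℝ E) (ε : ℝ) : Prop :=
  ∀ s ∈ T.faces, ∀ f₁ ∈ convexHull ℝ (s : Set E), ∀ f₂ ∈ convexHull ℝ (s : Set E), dist f₁ f₂ < ε

/-- `w` writes `f` as a weighted average of the vertices of one simplex of `T`. -/
def IsWeights (T : Geometry.SimplicialComplex ℝ E) [Fintype T.vertices] (f : E)
    (w : T.vertices → ℝ) : Prop :=
  (∃ s ∈ T.faces, ∀ v : T.vertices, w v ≠ 0 → (v : E) ∈ s) ∧ (∀ v, 0 ≤ w v) ∧ ∑ v, w v = 1 ∧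
    ∑ v, w v • (v : E) = f

open Classical in
/-- The test functions `w_v(f)`, for `f` in the space of `T`: the unique weights with which the
vertices of the simplex of `f` average to `f`. -/
def weight (T : Geometry.SimplicialComplex ℝ E) [Fintype T.vertices] (f : E) : T.vertices → ℝ :=
  if h : ∃ w, IsWeights T f w then h.choose else 0

/-- The piecewise linear extension of the update `v ↦ v - c v` of the vertices:
`ρ(f) = f - ∑ v, w_v(f) c_v`. Here `c v` is an average of terms "forecast minus outcome". -/
def update (T : Geometry.SimplicialComplex ℝ E) [Fintype T.vertices] (c : T.vertices → E) (f : E) :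
    E :=
  f - ∑ v, weight T f v • c v

/-- `f` is a fixed point of `ρ` followed by the nearest-point projection to `D`. If `ρ f ∈ D`, this
says `ρ f = f`. -/
def IsProjFixedPt (D : Set E) (ρ : E → E) (f : E) : Prop :=
  f ∈ D ∧ ∀ z ∈ D, dist (ρ f) f ≤ dist (ρ f) z

/-- The payoff of a randomized forecast `p` on the vertices of `T`, where a forecast predicts the
average of the statistic `φ` of the outcome: its entry at the vertex `v` is `p v • (v - φ y)`. -/
def vertexPayoff {Y : Type*} (T : Geometry.SimplicialComplex ℝ E) (φ : Y → E)
    (p : T.vertices → ℝ) (y : Y) : PiLp 2 fun _ : T.vertices => E :=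
  WithLp.toLp 2 fun v => p v • ((v : E) - φ y)

/-- The payoff of a deterministic forecast `f`, with its entries weighted by the test functions:
the entry at the vertex `v` is `w_v(f) • (f - φ y)`. -/
def pointPayoff {Y : Type*} (T : Geometry.SimplicialComplex ℝ E) [Fintype T.vertices] (φ : Y → E)
    (f : E) (y : Y) : PiLp 2 fun _ : T.vertices => E :=
  WithLp.toLp 2 fun v => weight T f v • (f - φ y)

/-- The fixed-point oracle on the triangulation `T` of the forecast space `D`, for outcomes in `S`
with statistic `φ`, is a half-space oracle. For every direction `c` there is a (projected) fixed
point `f` of the interpolated update; the randomized forecast that plays each vertex `v` with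
probability `w_v(f)` plays vertices at mutual distance less than `ε` only and solves the half-space
problem for the ball of radius `ε`; the deterministic forecast `f` solves it exactly. -/
def FixedPointOracle {Y : Type*} (D : Set E) (T : Geometry.SimplicialComplex ℝ E)
    [Fintype T.vertices] (φ : Y → E) (S : Set Y) (ε : ℝ) : Prop :=
  ∀ c : PiLp 2 fun _ : T.vertices => E, ∃ f : E,
    IsProjFixedPt D (update T fun v => c v) f ∧
    weight T f ∈ stdSimplex ℝ T.vertices ∧
    (∀ v v' : T.vertices, weight T f v ≠ 0 → weight T f v' ≠ 0 → dist (v : E) v' < ε) ∧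
    Solves (vertexPayoff T φ) S ε c (weight T f) ∧
    Solves (pointPayoff T φ) S 0 c f

end Triangulation

/-! ### Moment-based calibration -/

/-- The statistic `(y, y ^ 2)`. -/
def moments (y : ℝ) : EuclideanSpace ℝ (Fin 2) := !₂[y, y ^ 2]

/-- The forecasts `(μ, σ)` of the first two moments of an outcome with `|y| ≤ B`. -/
def momentBox (B : ℝ) : Set (EuclideanSpace ℝ (Fin 2)) :=
  {f | f 0 ∈ Set.Icc (-B) B ∧ f 1 ∈ Set.Icc 0 (B ^ 2)}

/-- The regular grid with ticks `0, …, M` along each of the two dimensions of `momentBox B`. -/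
def momentGrid (B : ℝ) (M : ℕ) : Set (EuclideanSpace ℝ (Fin 2)) :=
  {f | ∃ i j : Fin (M + 1), f 0 = -B + 2 * B * ((i : ℕ) / M) ∧ f 1 = B ^ 2 * ((j : ℕ) / M)}

/-! ### Discretized distribution calibration -/

/-- Probability mass functions on `n` bins. -/
def pmfs (n : ℕ) : Set (EuclideanSpace ℝ (Fin n)) :=
  {f | (∀ k, 0 ≤ f k) ∧ ∑ k, f k = 1}

/-- Probability mass functions on `n` bins all of whose values are multiples of `1 / N`. -/
def pmfGrid (n N : ℕ) : Set (EuclideanSpace ℝ (Fin n)) :=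
  {f | ∃ m : Fin n → ℕ, ∑ k, m k = N ∧ ∀ k, f k = (m k : ℝ) / N}

/-- The probability mass function of the point mass at the bin of `y`. -/
def binIndicator {n : ℕ} (bin : ℝ → Fin n) (y : ℝ) : EuclideanSpace ℝ (Fin n) :=
  EuclideanSpace.single (bin y) 1

/-! ### Decision calibration -/

section Decision

variable {A X Y : Type*} [MeasurableSpace Y]

/-- `δ` is a Bayes decision rule for the utility `u`. -/
def IsBayesRule (u : A → Y → X → ℝ) (δ : Measure Y → X → A) : Prop :=
  ∀ (p : Measure Y) [IsProbabilityMeasure p] (x : X) (a : A),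
    ∫ y, u a y x ∂p ≤ ∫ y, u (δ p x) y x ∂p

/-- The payoff `E_{y' ∼ p} u(a, y', x) - u(a, y, x)`, indexed by actions `a`. -/
def actionPayoff (u : A → Y → X → ℝ) (x : X) (p : Measure Y) (y : Y) : EuclideanSpace ℝ A :=
  WithLp.toLp 2 fun a => ∫ y', u a y' x ∂p - u a y x

open Classical in
/-- The payoff `𝟙{a' = δ(p, x)} (E_{y' ∼ p} u(a, y', x) - u(a, y, x))`, indexed by pairs of actions
`(a, a')`. -/
def swapPayoff (u : A → Y → X → ℝ) (δ : Measure Y → X → A) (x : X) (p : Measure Y) (y : Y) :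
    EuclideanSpace ℝ (A × A) :=
  WithLp.toLp 2 fun b => if b.2 = δ p x then ∫ y', u b.1 y' x ∂p - u b.1 y x else 0

/-- The forecast that gives mass `f k` to the outcome `r k`. -/
def discreteForecast {n : ℕ} (r : Fin n → Y) (f : EuclideanSpace ℝ (Fin n)) : Measure Y :=
  ∑ k, ENNReal.ofReal (f k) • Measure.dirac (r k)

/-- The expected swap payoff of the randomized forecast that plays `discreteForecast r v` with
probability `w v`, for `v` a vertex of `T`. -/
def randSwapPayoff {n : ℕ} [Fintype A] (u : A → Y → X → ℝ) (δ : Measure Y → X → A) (x : X)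
    (r : Fin n → Y) (T : Geometry.SimplicialComplex ℝ (EuclideanSpace ℝ (Fin n)))
    [Fintype T.vertices] (w : T.vertices → ℝ) (y : Y) : EuclideanSpace ℝ (A × A) :=
  ∑ v, w v • swapPayoff u δ x (discreteForecast r (v : EuclideanSpace ℝ (Fin n))) y

/-- The direction in the space of vertex-indexed forecast errors that corresponds to the direction
`c` in the space of swap payoffs:
`⟪c, swap payoff of v at r k⟫ = ⟪swapDirection v, v - e_k⟫`. -/
def swapDirection {n : ℕ} [Fintype A] (u : A → Y → X → ℝ) (δ : Measure Y → X → A) (x : X)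
    (r : Fin n → Y) (c : EuclideanSpace ℝ (A × A)) (v : EuclideanSpace ℝ (Fin n)) :
    EuclideanSpace ℝ (Fin n) :=
  WithLp.toLp 2 fun k => ∑ a, c (a, δ (discreteForecast r v) x) * u a (r k) x

end Decision

end HalfSpace

end

/-! Moment calibration, distribution calibration and the randomized decision oracle share one
fixed-point argument. The barycentric weights of a finite triangulation are continuous, so the
interpolated update `ρ` is continuous on `D`. Brouwer's theorem, applied to `ρ` followed by the
nearest-point projection, gives `f ∈ D` with `⟪ρ f - f, z - f⟫ ≤ 0` for all `z ∈ D`, that is, `⟪∑ v,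
w_v(f) c_v, f - z⟫ ≤ 0`. For `z = φ y` this is the exact guarantee of the deterministic forecast
`f`. The randomized forecast has errors `v - z = (v - f) + (f - z)`; the second summand is harmless,
and the first has norm below the mesh (`IsWeights.sum_mul_inner_le`).

Brouwer's theorem comes from a volume argument: a smooth retraction `r` of a ball onto its sphere
would make the integral of `det D((1 - t) id + t r)` a polynomial in `t` that is the volume of the
ball for small `t > 0` and zero at `t = 1`.

The grid triangulations are affine images of Kuhn's: its simplices are chains of integer points in a
unit cube. A point `x` is the mean of its roundings `⌊x + θ⌋` for uniform `θ`, which puts it in a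
simplex; the order structure of chains makes its weights unique.

The quantile-based oracles are elementary. In conformal inference, at a descending sign change two
adjacent levels can be mixed so that `β` cancels and monotonicity of coverage decides the sign; in
the remaining case the smallest `|c i|` is at most the average. In quantile calibration, some
threshold does at least as well as a uniformly random one. For decision calibration, a point mass at
a minimizer of `∑ a, c a * u a y x` solves the problem for action payoffs; for swap payoffs, a
finite net of outcomes makes the expected utilities linear in the probability vector and reduces the
problem to the fixed-point argument. -/

namespace HalfSpace

/-! ### Brouwer's fixed point theorem -/

section Brouwer

open Metric Set Filter Topology Polynomial
open scoped NNReal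

/-- Lagrange interpolation at `n + 1` nodes in `(0, δ)`. The coefficients do not depend on the
polynomial, so the formula can be used pointwise under an integral to carry an identity from small
`t` to `t = 1`. -/
lemma exists_eval_one_eq_sum (n : ℕ) {δ : ℝ} (hδ : 0 < δ) :
    ∃ (s : Finset ℝ) (l : ℝ → ℝ), (∀ t ∈ s, 0 < t ∧ t < δ) ∧
      ∀ p : ℝ[X], p.natDegree ≤ n → p.eval 1 = ∑ t ∈ s, l t * p.eval t := by
  classical
  obtain ⟨s, hs, hcard⟩ := (Set.Ioo_infinite hδ).exists_subset_card_eq (n + 1)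
  refine ⟨s, fun t => (Lagrange.basis s id t).eval 1, fun t ht => hs ht, fun p hp => ?_⟩
  have hdeg : p.degree < s.card :=
    (degree_le_natDegree).trans_lt (by rw [hcard]; exact_mod_cast Nat.lt_succ_of_le hp)
  conv_lhs => rw [Lagrange.eq_interpolate (v := id) (fun _ _ _ _ h => h) hdeg]
  simp only [Lagrange.interpolate_apply, eval_finsetSum, eval_mul, eval_C, id]
  exact Finset.sum_congr rfl fun t _ => mul_comm _ _

variable {E : Type*} [NormedAddCommGroup E] [InnerProductSpace ℝ E] [FiniteDimensional ℝ E]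

lemma exists_polynomial_eval_eq_det (A : E →L[ℝ] E) :
    ∃ p : ℝ[X], p.natDegree ≤ Module.finrank ℝ E ∧
      ∀ t : ℝ, p.eval t = (ContinuousLinearMap.id ℝ E + t • A).det := by
  let b := Module.finBasis ℝ E
  let M := LinearMap.toMatrix b b (A : E →ₗ[ℝ] E)
  let one : Matrix (Fin (Module.finrank ℝ E)) (Fin (Module.finrank ℝ E)) ℝ := 1
  refine ⟨((X : ℝ[X]) • M.map C + one.map C).det, ?_, fun t => ?_⟩
  · exact (natDegree_det_X_add_C_le M 1).trans_eq (Fintype.card_fin _)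
  · rw [eval_det, ContinuousLinearMap.det, ← LinearMap.det_toMatrix b]
    congr 1
    ext i j
    simp [M, one, LinearMap.toMatrix_apply, Matrix.one_apply, add_comm,
      mul_comm, Finsupp.single_apply, eq_comm]

omit [FiniteDimensional ℝ E] in
lemma injective_id_add_of_norm_lt_one {A : E →L[ℝ] E} (hA : ‖A‖ < 1) :
    Function.Injective (ContinuousLinearMap.id ℝ E + A) := by
  rw [injective_iff_map_eq_zero]
  intro x hx
  by_contra h
  have h1 : A x = -x := by
    have : x + A x = 0 := hx
    exact (neg_eq_of_add_eq_zero_right this).symm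
  have h2 := A.le_opNorm x
  rw [h1, norm_neg] at h2
  nlinarith [norm_pos_iff.2 h]

/-- Along the segment from the identity to `id + A` every map is injective, so the determinant,
which starts at 1, never vanishes and keeps its sign. -/
lemma det_id_add_pos {A : E →L[ℝ] E} (hA : ‖A‖ < 1) :
    0 < (ContinuousLinearMap.id ℝ E + A).det := by
  have hc : Continuous fun s : ℝ => (ContinuousLinearMap.id ℝ E + s • A).det :=
    ContinuousLinearMap.continuous_det.comp (by fun_prop)
  have hne : ∀ s ∈ Icc (0 : ℝ) 1, (ContinuousLinearMap.id ℝ E + s • A).det ≠ 0 := by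
    intro s hs h0
    have hn : ‖s • A‖ < 1 := by
      rw [norm_smul, Real.norm_of_nonneg hs.1]
      nlinarith [hs.2, norm_nonneg A]
    have hinj := injective_id_add_of_norm_lt_one hn
    have := LinearMap.bot_lt_ker_of_det_eq_zero h0
    exact this.ne' (LinearMap.ker_eq_bot.2 hinj)
  by_contra h
  push Not at h
  have h1 : (1 : ℝ) ∈ Icc (0 : ℝ) 1 := by simp
  have h0 : (0 : ℝ) ∈ Icc (0 : ℝ) 1 := by simp
  have := (isPreconnected_Icc (a := (0 : ℝ)) (b := 1)).intermediate_value h1 h0 hc.continuousOn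
  have hz : (0 : ℝ) ∈ Icc ((ContinuousLinearMap.id ℝ E + (1 : ℝ) • A).det)
      ((ContinuousLinearMap.id ℝ E + (0 : ℝ) • A).det) := by
    constructor
    · simpa using h
    · simp [ContinuousLinearMap.det]
  obtain ⟨s, hs, hs0⟩ := this hz
  exact hne s hs hs0

variable [MeasurableSpace E] [BorelSpace E]

/-- A closed ball has no continuously differentiable retraction onto its sphere. -/
theorem no_smooth_retraction {ρ : ℝ} (hρ : 0 < ρ) {r : E → E}
    (hr : ∀ x ∈ closedBall (0 : E) ρ, ContDiffAt ℝ 1 r x)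
    (hnorm : ∀ x ∈ closedBall (0 : E) ρ, ‖r x‖ = ρ) (hid : ∀ x, ‖x‖ = ρ → r x = x) : False := by
  -- The maps `x + t • g x = (1 - t) • x + t • r x` deform the identity into `r`. For small `t > 0`
  -- they are bijections of the open ball, so their Jacobians integrate to its volume.
  set g : E → E := fun x => r x - x with hg
  have hgd : ∀ x ∈ closedBall (0 : E) ρ, ContDiffAt ℝ 1 g x :=
    fun x hx => (hr x hx).sub contDiffAt_id
  have hcont : ContinuousOn (fderiv ℝ g) (closedBall (0 : E) ρ) := fun x hx =>
    ((hgd x hx).fderiv_right (m := 0) (by norm_num)).continuousAt.continuousWithinAt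
  obtain ⟨K₀, hK₀⟩ := (isCompact_closedBall (0 : E) ρ).exists_bound_of_continuousOn hcont
  obtain ⟨K, hK⟩ : ∃ K : ℝ≥0, ∀ x ∈ closedBall (0 : E) ρ, ‖fderiv ℝ g x‖₊ ≤ K :=
    ⟨K₀.toNNReal, fun x hx => by
      rw [← NNReal.coe_le_coe, coe_nnnorm]
      exact (hK₀ x hx).trans (Real.le_coe_toNNReal _)⟩
  have hlip : LipschitzOnWith K g (closedBall (0 : E) ρ) :=
    Convex.lipschitzOnWith_of_nnnorm_fderiv_le
      (fun x hx => (hgd x hx).differentiableAt (by norm_num)) hK (convex_closedBall _ _)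
  have hK1 : (0 : ℝ) < K + 1 := by positivity
  have hmemc : ∀ {x : E}, x ∈ ball (0 : E) ρ → x ∈ closedBall (0 : E) ρ :=
    fun h => ball_subset_closedBall h
  have hsmall : ∀ t : ℝ, 0 < t → t < 1 / (K + 1) →
      ∫ x in ball (0 : E) ρ, (ContinuousLinearMap.id ℝ E + t • fderiv ℝ g x).det =
        volume.real (ball (0 : E) ρ) := by
    intro t ht0 ht
    have htK : t * K < 1 := by
      rw [lt_div_iff₀ hK1] at ht
      nlinarith
    have ht1 : t < 1 := ht.trans_le (by rw [div_le_one hK1]; simp)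
    set φ : E → E := fun x => x + t • g x with hφ
    have hnt : ∀ x ∈ closedBall (0 : E) ρ, ‖t • fderiv ℝ g x‖ < 1 := by
      intro x hx
      rw [norm_smul, Real.norm_of_nonneg ht0.le]
      have : ‖fderiv ℝ g x‖ ≤ K := hK x hx
      nlinarith
    have hder : ∀ x ∈ closedBall (0 : E) ρ,
        HasStrictFDerivAt φ (ContinuousLinearMap.id ℝ E + t • fderiv ℝ g x) x := fun x hx =>
      (hasStrictFDerivAt_id x).add (((hgd x hx).hasStrictFDerivAt (by norm_num)).const_smul t)
    -- `t • g` is a strict contraction because `t * K < 1`, so adding it to the identity cannot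
    -- merge two points.
    have hinj : InjOn φ (closedBall (0 : E) ρ) := by
      intro x hx y hy hxy
      by_contra hne
      have h1 : x - y = t • (g y - g x) := by
        have : x + t • g x = y + t • g y := hxy
        rw [smul_sub, sub_eq_sub_iff_add_eq_add, this, add_comm]
      have h2 : ‖g y - g x‖ ≤ K * ‖y - x‖ := by
        simpa [dist_eq_norm] using hlip.dist_le_mul y hy x hx
      have h3 : ‖x - y‖ = t * ‖g y - g x‖ := by
        rw [h1, norm_smul, Real.norm_of_nonneg ht0.le]
      have h4 : 0 < ‖x - y‖ := norm_pos_iff.2 (sub_ne_zero.2 hne)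
      rw [norm_sub_rev y x] at h2
      nlinarith [mul_le_mul_of_nonneg_left h2 ht0.le]
    have hφcont : ContinuousOn φ (closedBall (0 : E) ρ) :=
      fun x hx => (hder x hx).continuousAt.continuousWithinAt
    have hopen : IsOpen (φ '' ball (0 : E) ρ) := by
      rw [isOpen_iff_mem_nhds]
      rintro _ ⟨x, hx, rfl⟩
      have hsurj : (ContinuousLinearMap.id ℝ E + t • fderiv ℝ g x).range = ⊤ := by
        have := injective_id_add_of_norm_lt_one (hnt x (hmemc hx))
        exact LinearMap.range_eq_top.2 (LinearMap.injective_iff_surjective.1 this)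
      rw [← (hder x (hmemc hx)).map_nhds_eq_of_surj hsurj]
      exact image_mem_map (isOpen_ball.mem_nhds hx)
    have hφeq : ∀ x, φ x = (1 - t) • x + t • r x := by
      intro x
      simp only [hφ, hg, smul_sub, sub_smul, one_smul]
      abel
    have hmaps : φ '' ball (0 : E) ρ ⊆ ball 0 ρ := by
      rintro _ ⟨x, hx, rfl⟩
      have hx' := hnorm x (hmemc hx)
      rw [mem_ball_zero_iff] at hx ⊢
      calc ‖φ x‖ ≤ ‖(1 - t) • x‖ + ‖t • r x‖ := by rw [hφeq]; exact norm_add_le _ _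
        _ = (1 - t) * ‖x‖ + t * ρ := by
          rw [norm_smul, norm_smul, hx', Real.norm_of_nonneg ht0.le,
            Real.norm_of_nonneg (by linarith)]
        _ < ρ := by nlinarith
    have hclosed : IsClosed (φ '' closedBall (0 : E) ρ) :=
      ((isCompact_closedBall (0 : E) ρ).image_of_continuousOn hφcont).isClosed
    have himage : φ '' ball (0 : E) ρ = ball 0 ρ := by
      -- Connectedness: since `φ` fixes the sphere pointwise, each point of the open ball lies
      -- either in the open image of the open ball or off the compact image of the closed ball.
      -- These are disjoint open sets, and the first one meets the ball.
      refine hmaps.antisymm ?_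
      refine IsPreconnected.subset_left_of_subset_union (v := (φ '' closedBall (0 : E) ρ)ᶜ)
        hopen hclosed.isOpen_compl ?_ ?_ ?_ (convex_ball (0 : E) ρ).isPreconnected
      · exact disjoint_compl_right.mono_left (image_mono ball_subset_closedBall)
      · intro y hy
        by_cases h : y ∈ φ '' closedBall (0 : E) ρ
        · left
          obtain ⟨x, hx, rfl⟩ := h
          refine ⟨x, ?_, rfl⟩
          rw [mem_closedBall_zero_iff] at hx
          rw [mem_ball_zero_iff] at hy ⊢
          refine lt_of_le_of_ne hx fun h => ?_
          have : φ x = x := by simp [hφ, hg, hid x h]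
          rw [this] at hy
          exact hy.ne h
        · exact Or.inr h
      · exact ⟨φ 0, hmaps ⟨0, mem_ball_self hρ, rfl⟩, 0, mem_ball_self hρ, rfl⟩
    have hcov := integral_image_eq_integral_abs_det_fderiv_smul (volume : Measure E)
      (measurableSet_ball (x := (0 : E)) (ε := ρ))
      (fun x hx => (hder x (hmemc hx)).hasFDerivAt.hasFDerivWithinAt)
      (hinj.mono ball_subset_closedBall) (fun _ => (1 : ℝ))
    rw [himage] at hcov
    have h2 : ∫ x in ball (0 : E) ρ, (1 : ℝ) = volume.real (ball (0 : E) ρ) := by simp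
    rw [← h2, hcov]
    refine setIntegral_congr_fun measurableSet_ball fun x hx => ?_
    simp [abs_of_pos (det_id_add_pos (hnt x (hmemc hx)))]
  have hint : ∀ t : ℝ, IntegrableOn
      (fun x => (ContinuousLinearMap.id ℝ E + t • fderiv ℝ g x).det) (ball (0 : E) ρ) := by
    intro t
    refine IntegrableOn.mono_set (t := closedBall (0 : E) ρ) ?_ ball_subset_closedBall
    refine ContinuousOn.integrableOn_compact (isCompact_closedBall _ _) ?_
    exact ContinuousLinearMap.continuous_det.comp_continuousOn
      (continuousOn_const.add (hcont.const_smul t))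
  obtain ⟨s, l, hs, hl⟩ := exists_eval_one_eq_sum (Module.finrank ℝ E)
    (show (0 : ℝ) < 1 / (K + 1) by positivity)
  have hone : ∫ x in ball (0 : E) ρ, (ContinuousLinearMap.id ℝ E + (1 : ℝ) • fderiv ℝ g x).det =
      volume.real (ball (0 : E) ρ) := by
    -- At each `x` the determinant is a polynomial in `t` of degree at most the dimension; the same
    -- nodes and coefficients serve every `x`.
    have hpt : ∀ x, (ContinuousLinearMap.id ℝ E + (1 : ℝ) • fderiv ℝ g x).det =
        ∑ t ∈ s, l t * (ContinuousLinearMap.id ℝ E + t • fderiv ℝ g x).det := by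
      intro x
      obtain ⟨p, hp, hp'⟩ := exists_polynomial_eval_eq_det (fderiv ℝ g x)
      simpa only [hp'] using hl p hp
    simp_rw [hpt]
    rw [integral_finsetSum _ fun t _ => (hint t).const_mul _]
    have hl1 := hl 1 (by simp)
    simp only [eval_one, mul_one] at hl1
    calc ∑ t ∈ s, ∫ x in ball (0 : E) ρ,
          l t * (ContinuousLinearMap.id ℝ E + t • fderiv ℝ g x).det
        = ∑ t ∈ s, l t * volume.real (ball (0 : E) ρ) := by
          refine Finset.sum_congr rfl fun t ht => ?_
          rw [integral_const_mul, hsmall t (hs t ht).1 (hs t ht).2]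
      _ = volume.real (ball (0 : E) ρ) := by rw [← Finset.sum_mul, ← hl1, one_mul]
  have hzero : ∀ x ∈ ball (0 : E) ρ,
      (ContinuousLinearMap.id ℝ E + (1 : ℝ) • fderiv ℝ g x).det = 0 := by
    intro x hx
    have hrd : HasFDerivAt r (fderiv ℝ r x) x :=
      ((hr x (hmemc hx)).differentiableAt (by norm_num)).hasFDerivAt
    have hgr : ContinuousLinearMap.id ℝ E + (1 : ℝ) • fderiv ℝ g x = fderiv ℝ r x := by
      have : HasFDerivAt g (fderiv ℝ r x - ContinuousLinearMap.id ℝ E) x :=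
        hrd.sub (hasFDerivAt_id x)
      rw [this.fderiv]
      simp
    rw [hgr]
    by_contra hdet
    -- Differentiating `‖r‖ ^ 2 = ρ ^ 2` makes the range of the derivative orthogonal to `r x ≠ 0`,
    -- so the derivative cannot be surjective.
    have hperp : ∀ z, inner ℝ (r x) (fderiv ℝ r x z) = 0 := by
      intro z
      have h1 : HasFDerivAt (fun y => inner ℝ (r y) (r y)) _ x := hrd.inner ℝ hrd
      have h2 : HasFDerivAt (fun y => inner ℝ (r y) (r y)) (0 : E →L[ℝ] ℝ) x := by
        refine (hasFDerivAt_const (ρ ^ 2) x).congr_of_eventuallyEq ?_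
        filter_upwards [isOpen_ball.mem_nhds hx] with y hy
        rw [real_inner_self_eq_norm_sq, hnorm y (hmemc hy)]
      have h3 := congrArg (fun L : E →L[ℝ] ℝ => L z) (h1.unique h2)
      simp only [ContinuousLinearMap.coe_comp, Function.comp_apply,
        ContinuousLinearMap.prod_apply, fderivInnerCLM_apply, zero_apply] at h3
      rw [real_inner_comm (r x) (fderiv ℝ r x z)] at h3
      linarith
    have hsurj : Function.Surjective (fderiv ℝ r x) := by
      have hinj : Function.Injective (fderiv ℝ r x : E →ₗ[ℝ] E) := by
        by_contra hni
        exact hdet (LinearMap.det_eq_zero_iff_ker_ne_bot.2 fun h => hni (LinearMap.ker_eq_bot.1 h))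
      exact LinearMap.injective_iff_surjective.1 hinj
    obtain ⟨z, hz⟩ := hsurj (r x)
    have := hperp z
    rw [hz, real_inner_self_eq_norm_sq, hnorm x (hmemc hx)] at this
    exact (pow_pos hρ 2).ne' this
  rw [setIntegral_congr_fun measurableSet_ball hzero] at hone
  have hpos : 0 < volume.real (ball (0 : E) ρ) :=
    ENNReal.toReal_pos (measure_ball_pos _ _ hρ).ne' measure_ball_lt_top.ne
  simp at hone
  exact hpos.ne hone

/-- A bounded continuous self-map of a finite-dimensional space has a fixed point. -/
theorem exists_fixedPt_of_bounded {F : E → E} (hF : Continuous F) {R : ℝ}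
    (hR : ∀ x, ‖F x‖ ≤ R) : ∃ x, F x = x := by
  by_contra hne
  push Not at hne
  have hR0 : 0 ≤ R := (norm_nonneg _).trans (hR 0)
  set ρ := R + 1 with hρ
  have hρ0 : 0 < ρ := by positivity
  obtain ⟨x₀, -, hx₀⟩ := (isCompact_closedBall (0 : E) ρ).exists_isMinOn
    ⟨0, mem_closedBall_self hρ0.le⟩ (f := fun x => ‖x - F x‖) (by fun_prop)
  -- Staying within the least displacement of `F` keeps the smooth approximation free of fixed
  -- points in the ball; staying within 1 keeps its norm below `ρ = R + 1`.
  set δ := min (‖x₀ - F x₀‖) 1 with hδ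
  have hδ0 : 0 < δ := lt_min (norm_pos_iff.2 (sub_ne_zero.2 (hne x₀).symm)) one_pos
  obtain ⟨G, hG, hGF, -⟩ := hF.exists_contDiff_approx 1 (ε := fun _ => δ) continuous_const
    fun _ => hδ0
  have hGn : ∀ x, ‖G x‖ < ρ := fun x => by
    have h1 := hGF x
    rw [dist_eq_norm] at h1
    have h2 := norm_add_le (G x - F x) (F x)
    rw [sub_add_cancel] at h2
    linarith [hR x, min_le_right (‖x₀ - F x₀‖) 1]
  have hu : ∀ x ∈ closedBall (0 : E) ρ, 0 < ‖x - G x‖ ^ 2 := by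
    intro x hx
    refine pow_pos (norm_pos_iff.2 fun h => ?_) 2
    have h1 := hGF x
    rw [← sub_eq_zero.1 h, dist_eq_norm] at h1
    have h2 : ‖x₀ - F x₀‖ ≤ ‖x - F x‖ := hx₀ hx
    linarith [min_le_left (‖x₀ - F x₀‖) 1]
  set u : E → E := fun x => x - G x with hudef
  set b : E → ℝ := fun x => inner ℝ x (u x) with hb
  -- A quarter of the discriminant of `‖x + s • u x‖ ^ 2 = ρ ^ 2` in `s`. The larger root `s` gives
  -- the point where the ray from `G x` through `x` leaves the ball; positivity of `d` makes the
  -- root smooth in `x`.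
  set d : E → ℝ := fun x => b x ^ 2 + ‖u x‖ ^ 2 * (ρ ^ 2 - ‖x‖ ^ 2) with hd
  -- As `G` takes values in the open ball, the ray points outwards on the sphere. Hence `√d = b`
  -- there, and the retraction fixes the sphere.
  have hbpos : ∀ x, ‖x‖ = ρ → 0 < b x := by
    intro x hx
    simp only [hb, hudef, inner_sub_right, real_inner_self_eq_norm_sq]
    have := real_inner_le_norm x (G x)
    rw [hx] at this ⊢
    nlinarith [hGn x]
  have hdpos : ∀ x ∈ closedBall (0 : E) ρ, 0 < d x := by
    intro x hx
    have hux := hu x hx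
    rw [mem_closedBall_zero_iff] at hx
    rcases hx.lt_or_eq with h | h
    · have h1 : 0 < ρ ^ 2 - ‖x‖ ^ 2 := by nlinarith [norm_nonneg x]
      have := mul_pos hux h1
      simp only [hd]
      nlinarith [sq_nonneg (b x)]
    · have := hbpos x h
      simp only [hd, h]
      nlinarith
  have huc : ContDiff ℝ 1 u := contDiff_id.sub hG
  have hbc : ContDiff ℝ 1 b := contDiff_id.inner ℝ huc
  have hdc : ContDiff ℝ 1 d :=
    (hbc.pow 2).add ((huc.norm_sq ℝ).mul (contDiff_const.sub (contDiff_id.norm_sq ℝ)))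
  refine no_smooth_retraction hρ0
    (r := fun x => x + ((Real.sqrt (d x) - b x) / ‖u x‖ ^ 2) • u x) ?_ ?_ ?_
  · intro x hx
    exact contDiffAt_id.add ((((hdc.contDiffAt.sqrt (hdpos x hx).ne').sub hbc.contDiffAt).div
      (huc.norm_sq ℝ).contDiffAt (hu x hx).ne').smul huc.contDiffAt)
  · intro x hx
    have hsq := Real.sq_sqrt (hdpos x hx).le
    have h : ‖x + ((Real.sqrt (d x) - b x) / ‖u x‖ ^ 2) • u x‖ ^ 2 = ρ ^ 2 := by
      rw [norm_add_sq_real, inner_smul_right, norm_smul, mul_pow, Real.norm_eq_abs, sq_abs]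
      change ‖x‖ ^ 2 + 2 * ((Real.sqrt (d x) - b x) / ‖u x‖ ^ 2 * b x) + _ = _
      have hne' : ‖u x‖ ^ 2 ≠ 0 := (hu x hx).ne'
      have : ((Real.sqrt (d x) - b x) / ‖u x‖ ^ 2) ^ 2 * ‖u x‖ ^ 2 =
          (Real.sqrt (d x) - b x) ^ 2 / ‖u x‖ ^ 2 := by field_simp
      rw [this]
      have h2 : 2 * ((Real.sqrt (d x) - b x) / ‖u x‖ ^ 2 * b x) +
          (Real.sqrt (d x) - b x) ^ 2 / ‖u x‖ ^ 2 = (Real.sqrt (d x) ^ 2 - b x ^ 2) / ‖u x‖ ^ 2 := by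
        ring
      rw [add_assoc, h2, hsq]
      simp only [hd, add_sub_cancel_left]
      rw [mul_div_cancel_left₀ _ hne']
      ring
    exact (pow_left_inj₀ (norm_nonneg _) hρ0.le two_ne_zero).1 h
  · intro x hx
    have : Real.sqrt (d x) = b x := by
      simp only [hd, hx, sub_self, mul_zero, add_zero]
      exact Real.sqrt_sq (hbpos x hx).le
    simp [this]

end Brouwer

/-! ### Projected fixed points -/

section Projection

open Metric Set Filter Topology

variable {E : Type*} [NormedAddCommGroup E] [InnerProductSpace ℝ E]

lemma exists_continuous_projection [CompleteSpace E] {D : Set E} (hne : D.Nonempty)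
    (hcl : IsClosed D) (hconv : Convex ℝ D) :
    ∃ P : E → E, Continuous P ∧ (∀ x, P x ∈ D) ∧
      ∀ x, ∀ z ∈ D, inner ℝ (x - P x) (z - P x) ≤ 0 := by
  choose P hPD hP using exists_norm_eq_iInf_of_complete_convex hne hcl.isComplete hconv
  have hinner : ∀ x, ∀ z ∈ D, inner ℝ (x - P x) (z - P x) ≤ 0 := fun x =>
    (norm_eq_iInf_iff_real_inner_le_zero hconv (hPD x)).1 (hP x)
  refine ⟨P, ?_, hPD, hinner⟩
  refine (LipschitzWith.of_dist_le_mul (K := 1) fun x y => ?_).continuous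
  rw [NNReal.coe_one, one_mul, dist_eq_norm, dist_eq_norm]
  have h1 := hinner x (P y) (hPD y)
  have h2 := hinner y (P x) (hPD x)
  -- The sum of the two obtuse-angle inequalities; with Cauchy-Schwarz it gives the Lipschitz
  -- constant 1.
  have h3 : ‖P x - P y‖ ^ 2 ≤ inner ℝ (x - y) (P x - P y) := by
    rw [← real_inner_self_eq_norm_sq]
    simp only [inner_sub_left, inner_sub_right] at h1 h2 ⊢
    rw [real_inner_comm (P x) (P y)] at *
    linarith
  have h4 := real_inner_le_norm (x - y) (P x - P y)
  by_contra h
  push Not at h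
  nlinarith [norm_nonneg (x - y), norm_nonneg (P x - P y)]

lemma exists_variational_solution [FiniteDimensional ℝ E] {D : Set E} (hne : D.Nonempty)
    (hcomp : IsCompact D) (hconv : Convex ℝ D) {ρ : E → E} (hρ : ContinuousOn ρ D) :
    ∃ f ∈ D, ∀ z ∈ D, inner ℝ (ρ f - f) (z - f) ≤ 0 := by
  let _ : MeasurableSpace E := borel E
  have : BorelSpace E := ⟨rfl⟩
  obtain ⟨P, hPc, hPD, hP⟩ := exists_continuous_projection hne hcomp.isClosed hconv
  obtain ⟨R, hR⟩ := hcomp.isBounded.exists_norm_le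
  -- The inner projection extends `ρ`, continuous only on `D`, to the whole space; the outer one
  -- makes the map bounded.
  obtain ⟨f, hf⟩ := exists_fixedPt_of_bounded (F := fun x => P (ρ (P x)))
    (hPc.comp (hρ.comp_continuous hPc hPD)) (fun x => hR _ (hPD _))
  have hfD : f ∈ D := hf ▸ hPD _
  have hPf : P f = f := by
    have := hP f f hfD
    rw [real_inner_self_eq_norm_sq] at this
    have h0 : ‖f - P f‖ = 0 := by nlinarith [norm_nonneg (f - P f)]
    exact (sub_eq_zero.1 (norm_eq_zero.1 h0)).symm
  refine ⟨f, hfD, fun z hz => ?_⟩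
  have := hP (ρ f) z hz
  simp only [hPf] at hf
  rwa [hf] at this

lemma isProjFixedPt_of_inner_le_zero {D : Set E} {ρ : E → E} {f : E} (hf : f ∈ D)
    (h : ∀ z ∈ D, inner ℝ (ρ f - f) (z - f) ≤ 0) : IsProjFixedPt D ρ f := by
  refine ⟨hf, fun z hz => ?_⟩
  rw [dist_eq_norm, dist_eq_norm]
  have h1 : ‖ρ f - z‖ ^ 2 = ‖ρ f - f‖ ^ 2 - 2 * inner ℝ (ρ f - f) (z - f) + ‖z - f‖ ^ 2 := by
    rw [← norm_sub_sq_real, sub_sub_sub_cancel_right]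
  have h2 := h z hz
  by_contra hlt
  push Not at hlt
  nlinarith [norm_nonneg (ρ f - z), norm_nonneg (ρ f - f), sq_nonneg ‖z - f‖]

end Projection

/-! ### Weights of a triangulation -/

section Weights

open Metric Set Filter Topology

variable {E : Type*} [NormedAddCommGroup E] [InnerProductSpace ℝ E]
  {T : Geometry.SimplicialComplex ℝ E}

lemma mem_vertices_of_mem_face {s : Finset E} (hs : s ∈ T.faces) {x : E} (hx : x ∈ s) :
    x ∈ T.vertices := by
  rw [T.vertices_eq]
  exact mem_biUnion hs (Finset.mem_coe.2 hx)

variable [Fintype T.vertices]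

lemma sum_vertices_eq_sum_face {F : Type*} [AddCommMonoid F] {s : Finset E} (hs : s ∈ T.faces)
    (g : T.vertices → F) (hg : ∀ v : T.vertices, (v : E) ∉ s → g v = 0) :
    ∑ v, g v = ∑ x : s, g ⟨x, mem_vertices_of_mem_face hs x.2⟩ := by
  symm
  refine Fintype.sum_of_injective (fun x : s => (⟨x, mem_vertices_of_mem_face hs x.2⟩ : T.vertices))
    ?_ _ _ ?_ fun _ => rfl
  · intro x y h
    exact Subtype.ext (congrArg (fun v : T.vertices => (v : E)) h)
  · intro v hv
    exact hg v fun h => hv ⟨⟨v, h⟩, rfl⟩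

lemma weights_eq_of_face {s : Finset E} (hs : s ∈ T.faces) {w w' : T.vertices → ℝ}
    (hw : ∀ v : T.vertices, w v ≠ 0 → (v : E) ∈ s) (hw' : ∀ v : T.vertices, w' v ≠ 0 → (v : E) ∈ s)
    (hsum : ∑ v, w v = ∑ v, w' v) (hcomb : ∑ v, w v • (v : E) = ∑ v, w' v • (v : E)) : w = w' := by
  have h0 : ∀ v : T.vertices, (v : E) ∉ s → w v - w' v = 0 := fun v hv => by
    rw [not_not.1 (mt (hw v) hv), not_not.1 (mt (hw' v) hv), sub_zero]
  have hind := T.indep hs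
  rw [affineIndependent_iff] at hind
  have key := hind Finset.univ (fun x : s => w ⟨x, mem_vertices_of_mem_face hs x.2⟩ -
    w' ⟨x, mem_vertices_of_mem_face hs x.2⟩) ?_ ?_
  · funext v
    by_cases hv : (v : E) ∈ s
    · exact sub_eq_zero.1 (key ⟨v, hv⟩ (Finset.mem_univ _))
    · exact sub_eq_zero.1 (h0 v hv)
  · rw [← sum_vertices_eq_sum_face hs (fun v => w v - w' v) h0, Finset.sum_sub_distrib, hsum,
      sub_self]
  · rw [← sum_vertices_eq_sum_face hs (fun v => (w v - w' v) • (v : E))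
      fun v hv => by rw [h0 v hv, zero_smul]]
    simp_rw [sub_smul]
    rw [Finset.sum_sub_distrib, hcomb, sub_self]

lemma exists_weights_of_mem_convexHull {s : Finset E} (hs : s ∈ T.faces) {f : E}
    (hf : f ∈ convexHull ℝ (s : Set E)) :
    ∃ w : T.vertices → ℝ, (∀ v : T.vertices, w v ≠ 0 → (v : E) ∈ s) ∧ (∀ v, 0 ≤ w v) ∧
      ∑ v, w v = 1 ∧ ∑ v, w v • (v : E) = f := by
  classical
  obtain ⟨u, hu0, hu1, huf⟩ := Finset.mem_convexHull'.1 hf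
  refine ⟨fun v => if (v : E) ∈ s then u v else 0, fun v hv => ?_, fun v => ?_, ?_, ?_⟩
  · by_contra h
    exact hv (if_neg h)
  · dsimp only
    split_ifs with h
    · exact hu0 _ h
    · exact le_rfl
  · rw [sum_vertices_eq_sum_face hs _ fun v hv => if_neg hv, ← hu1, ← Finset.sum_coe_sort s u]
    exact Finset.sum_congr rfl fun x _ => if_pos x.2
  · rw [sum_vertices_eq_sum_face hs _ fun v hv => by simp [hv], ← huf,
      ← Finset.sum_coe_sort s fun y => u y • y]
    exact Finset.sum_congr rfl fun x _ => by simp [x.2]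

lemma mem_convexHull_of_weights {s : Finset E} {w : T.vertices → ℝ} {f : E}
    (hw : ∀ v : T.vertices, w v ≠ 0 → (v : E) ∈ s) (h0 : ∀ v, 0 ≤ w v) (h1 : ∑ v, w v = 1)
    (hf : ∑ v, w v • (v : E) = f) : f ∈ convexHull ℝ (s : Set E) := by
  classical
  rw [← hf, ← Finset.sum_filter_of_ne (p := fun v => w v ≠ 0)
    (fun v _ h hv => h (by rw [hv, zero_smul]))]
  refine (convex_convexHull ℝ (s : Set E)).sum_mem (fun v _ => h0 v) ?_ fun v hv =>
    subset_convexHull ℝ _ (hw v (Finset.mem_filter.1 hv).2)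
  rw [Finset.sum_filter_ne_zero, h1]

/-- Two simplices that contain `f` meet in a common face that contains it. By affine independence,
each of the two weightings equals the one obtained from that face. -/
lemma IsWeights.unique {f : E} {w w' : T.vertices → ℝ} (hw : IsWeights T f w)
    (hw' : IsWeights T f w') : w = w' := by
  classical
  obtain ⟨⟨s, hs, hws⟩, h0, h1, hf⟩ := hw
  obtain ⟨⟨t, ht, hwt⟩, h0', h1', hf'⟩ := hw'
  have hmem := T.inter_subset_convexHull hs ht
    ⟨mem_convexHull_of_weights hws h0 h1 hf, mem_convexHull_of_weights hwt h0' h1' hf'⟩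
  rw [← Finset.coe_inter] at hmem
  have hface : s ∩ t ∈ T.faces := T.down_closed hs Finset.inter_subset_left
    (Finset.coe_nonempty.1 (convexHull_nonempty_iff.1 ⟨f, hmem⟩))
  obtain ⟨u, hu, -, hu1, huf⟩ := exists_weights_of_mem_convexHull hface hmem
  rw [weights_eq_of_face hs hws (fun v hv => (Finset.mem_inter.1 (hu v hv)).1) (h1.trans hu1.symm)
    (hf.trans huf.symm), weights_eq_of_face ht hwt (fun v hv => (Finset.mem_inter.1 (hu v hv)).2)
    (h1'.trans hu1.symm) (hf'.trans huf.symm)]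

lemma isWeights_weight {f : E} (hf : f ∈ T.space) : IsWeights T f (weight T f) := by
  obtain ⟨s, hs, hfs⟩ := T.mem_space_iff.1 hf
  obtain ⟨w, hw⟩ := exists_weights_of_mem_convexHull hs hfs
  have h : ∃ w, IsWeights T f w := ⟨w, ⟨s, hs, hw.1⟩, hw.2⟩
  rw [weight, dif_pos h]
  exact h.choose_spec

lemma IsWeights.mem_stdSimplex {f : E} {w : T.vertices → ℝ} (hw : IsWeights T f w) :
    w ∈ stdSimplex ℝ T.vertices :=
  ⟨hw.2.1, hw.2.2.1⟩

lemma finite_faces : T.faces.Finite := by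
  classical
  refine (Set.finite_range
    fun S : Finset T.vertices => S.map (Function.Embedding.subtype _)).subset fun s hs => ?_
  refine ⟨Finset.univ.filter fun v => (v : E) ∈ s, ?_⟩
  ext x
  simp only [Finset.mem_map, Finset.mem_filter, Finset.mem_univ, true_and,
    Function.Embedding.coe_subtype, Subtype.exists, exists_and_left, exists_prop,
    exists_eq_right_right]
  exact ⟨fun h => h.1, fun h => ⟨h, mem_vertices_of_mem_face hs h⟩⟩

/-- The condition is closed for each fixed face, and there are only finitely many faces. -/
lemma isClosed_isWeights :
    IsClosed {p : E × (T.vertices → ℝ) | IsWeights T p.1 p.2} := by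
  have : {p : E × (T.vertices → ℝ) | IsWeights T p.1 p.2} =
      (⋃ s ∈ T.faces, {p | ∀ v : T.vertices, (v : E) ∉ s → p.2 v = 0}) ∩
      ({p | ∀ v, 0 ≤ p.2 v} ∩ ({p | ∑ v, p.2 v = 1} ∩
        {p | ∑ v : T.vertices, p.2 v • (v : E) = p.1})) := by
    ext p
    simp only [IsWeights, mem_ofPred_eq, mem_inter_iff, mem_iUnion, exists_prop]
    simp only [ne_eq, not_imp_comm]
  rw [this]
  refine (finite_faces.isClosed_biUnion fun s _ => ?_).inter (.inter ?_ (.inter ?_ ?_))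
  · simp only [ofPred_forall]
    exact isClosed_iInter fun v => isClosed_iInter fun _ =>
      isClosed_eq (by fun_prop) continuous_const
  · simp only [ofPred_forall]
    exact isClosed_iInter fun v => isClosed_le continuous_const (by fun_prop)
  · exact isClosed_eq (by fun_prop) continuous_const
  · exact isClosed_eq (by fun_prop) (by fun_prop)

/-- Closed graph argument: the weights lie in a compact simplex, and by closedness and uniqueness
every cluster point at `f` is the weight vector of `f`. -/
lemma continuousOn_weight : ContinuousOn (weight T) T.space := by
  intro f hf
  refine (isCompact_stdSimplex (𝕜 := ℝ) T.vertices).tendsto_nhds_of_unique_mapClusterPt ?_ ?_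
  · filter_upwards [self_mem_nhdsWithin] with x hx using (isWeights_weight hx).mem_stdSimplex
  · intro w _ hw
    obtain ⟨U, hU, hUw⟩ := mapClusterPt_iff_ultrafilter.1 hw
    have hlim : Tendsto (fun x => (x, weight T x)) U (𝓝 (f, w)) :=
      Tendsto.prodMk_nhds (hU.trans nhdsWithin_le_nhds) hUw
    have := isClosed_isWeights.mem_of_tendsto hlim <|
      hU <| by
        filter_upwards [self_mem_nhdsWithin] with x hx using isWeights_weight hx
    exact IsWeights.unique this (isWeights_weight hf)

lemma continuousOn_update (c : T.vertices → E) : ContinuousOn (update T c) T.space :=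
  continuousOn_id.sub <| continuousOn_finsetSum _ fun v _ =>
    ((continuous_apply v).comp_continuousOn continuousOn_weight).smul continuousOn_const

lemma IsWeights.dist_lt {f : E} {w : T.vertices → ℝ} (hw : IsWeights T f w) {ε : ℝ}
    (hT : MeshLT T ε) {v v' : T.vertices} (hv : w v ≠ 0) (hv' : w v' ≠ 0) :
    dist (v : E) v' < ε := by
  obtain ⟨⟨s, hs, hws⟩, -⟩ := hw
  exact hT s hs _ (subset_convexHull ℝ _ (hws v hv)) _ (subset_convexHull ℝ _ (hws v' hv'))

lemma IsWeights.dist_vertex_lt {f : E} {w : T.vertices → ℝ} (hw : IsWeights T f w) {ε : ℝ}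
    (hT : MeshLT T ε) {v : T.vertices} (hv : w v ≠ 0) : dist (v : E) f < ε := by
  obtain ⟨⟨s, hs, hws⟩, h0, h1, hf⟩ := hw
  exact hT s hs _ (subset_convexHull ℝ _ (hws v hv)) _ (mem_convexHull_of_weights hws h0 h1 hf)

/-- A projected fixed point of the interpolated update is a forecast whose error is nonpositive in
the interpolated direction. -/
theorem exists_isProjFixedPt_update [FiniteDimensional ℝ E] {D : Set E} (hne : D.Nonempty)
    (hcomp : IsCompact D) (hconv : Convex ℝ D) (hD : T.space = D) (c : T.vertices → E) :
    ∃ f, IsProjFixedPt D (update T c) f ∧ IsWeights T f (weight T f) ∧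
      ∀ z ∈ D, inner ℝ (∑ v, weight T f v • c v) (f - z) ≤ 0 := by
  obtain ⟨f, hf, h⟩ := exists_variational_solution hne hcomp hconv
    (hD ▸ continuousOn_update c)
  refine ⟨f, isProjFixedPt_of_inner_le_zero hf h, isWeights_weight (hD ▸ hf), fun z hz => ?_⟩
  have := h z hz
  rwa [update, sub_sub_cancel_left, ← neg_sub f z, inner_neg_neg] at this

/-- Split `v - z = (v - f) + (f - z)`. The vertices with positive weight are within the mesh of `f`,
and the remaining part is the error of `f` in the interpolated direction. This is where the radius
`ε` of the randomized forecast comes from. -/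
lemma IsWeights.sum_mul_inner_le {f : E} {w : T.vertices → ℝ} (hw : IsWeights T f w) {ε : ℝ}
    (hT : MeshLT T ε) {c : T.vertices → E} {C : ℝ} (hc : ∀ v, ‖c v‖ ≤ C) {z : E}
    (hz : inner ℝ (∑ v, w v • c v) (f - z) ≤ 0) :
    ∑ v, w v * inner ℝ (c v) ((v : E) - z) ≤ ε * C := by
  have h1 : ∑ v, w v * inner ℝ (c v) ((v : E) - z) =
      ∑ v, w v * inner ℝ (c v) ((v : E) - f) + inner ℝ (∑ v, w v • c v) (f - z) := by
    rw [sum_inner, ← Finset.sum_add_distrib]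
    refine Finset.sum_congr rfl fun v _ => ?_
    rw [real_inner_smul_left, ← mul_add, ← inner_add_right, sub_add_sub_cancel]
  have h2 : ∑ v, w v * inner ℝ (c v) ((v : E) - f) ≤ ∑ v, w v * (ε * C) := by
    refine Finset.sum_le_sum fun v _ => ?_
    by_cases hv : w v = 0
    · simp [hv]
    refine mul_le_mul_of_nonneg_left ?_ (hw.2.1 v)
    have hd := (hw.dist_vertex_lt hT hv).le
    rw [dist_eq_norm] at hd
    calc inner ℝ (c v) ((v : E) - f) ≤ ‖c v‖ * ‖(v : E) - f‖ := real_inner_le_norm _ _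
      _ ≤ C * ε := mul_le_mul (hc v) hd (norm_nonneg _) ((norm_nonneg _).trans (hc v))
      _ = ε * C := mul_comm _ _
  rw [← Finset.sum_mul, hw.2.2.1, one_mul] at h2
  linarith

/-- The fixed-point oracle is a half-space oracle for every triangulation of a compact convex set
that contains the statistics of all outcomes. -/
theorem fixedPointOracle [FiniteDimensional ℝ E] {Y : Type*} {D : Set E} (hne : D.Nonempty)
    (hcomp : IsCompact D) (hconv : Convex ℝ D) (hD : T.space = D) {φ : Y → E} {S : Set Y}
    (hφ : ∀ y ∈ S, φ y ∈ D) {ε : ℝ} (hT : MeshLT T ε) : FixedPointOracle D T φ S ε := by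
  intro c
  obtain ⟨f, hfix, hw, hz⟩ := exists_isProjFixedPt_update hne hcomp hconv hD fun v => c v
  refine ⟨f, hfix, hw.mem_stdSimplex, fun v v' hv hv' => hw.dist_lt hT hv hv', ?_, ?_⟩
  · intro y hy
    rw [PiLp.inner_apply]
    simp only [vertexPayoff, real_inner_smul_right]
    exact hw.sum_mul_inner_le hT (fun v => PiLp.norm_apply_le c v) (hz _ (hφ y hy))
  · intro y hy
    rw [PiLp.inner_apply, zero_mul]
    refine le_of_eq_of_le ?_ (hz _ (hφ y hy))
    -- All entries of the deterministic payoff share the factor `f - φ y`, so the inner product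
    -- collapses to the interpolated direction and no mesh error arises.
    rw [sum_inner]
    exact Finset.sum_congr rfl fun v _ => by
      simp only [pointPayoff, real_inner_smul_right, real_inner_smul_left]

end Weights

/-! ### Affine images of simplicial complexes -/

section Map

variable {F E : Type*} [AddCommGroup F] [Module ℝ F] [AddCommGroup E] [Module ℝ E]

lemma affineIndependent_finset_map {α : Type*} {t : Finset α} {e : α ↪ E}
    (h : AffineIndependent ℝ fun x : t => e x) :
    AffineIndependent ℝ fun x : (t.map e : Finset E) => (x : E) := by
  refine h.range.mono (s := ((t.map e : Finset E) : Set E)) fun x hx => ?_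
  obtain ⟨y, hy, rfl⟩ := Finset.mem_map.1 (Finset.mem_coe.1 hx)
  exact ⟨⟨y, hy⟩, rfl⟩

/-- The image of a simplicial complex under an injective affine map. -/
def mapComplex (T : Geometry.SimplicialComplex ℝ F) (g : F →ᵃ[ℝ] E)
    (hg : Function.Injective g) : Geometry.SimplicialComplex ℝ E where
  faces := {s | ∃ t ∈ T.faces, s = t.map ⟨g, hg⟩}
  isRelLowerSet_faces := by
    classical
    rintro _ ⟨t, ht, rfl⟩
    refine ⟨(T.nonempty_of_mem_faces ht).map, fun s hs hne => ?_⟩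
    obtain ⟨u, hu, rfl⟩ := Finset.subset_map_iff.1 hs
    exact ⟨u, T.down_closed ht hu (Finset.map_nonempty.1 hne), rfl⟩
  indep := by
    rintro _ ⟨t, ht, rfl⟩
    exact affineIndependent_finset_map ((T.indep ht).map' g hg)
  inter_subset_convexHull := by
    rintro _ _ ⟨s, hs, rfl⟩ ⟨t, ht, rfl⟩
    simp only [Finset.coe_map, Function.Embedding.coeFn_mk]
    rw [← Set.image_inter hg, ← g.image_convexHull, ← g.image_convexHull, ← g.image_convexHull,
      ← Set.image_inter hg]
    exact Set.image_mono (T.inter_subset_convexHull hs ht)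

lemma mapComplex_space (T : Geometry.SimplicialComplex ℝ F) (g : F →ᵃ[ℝ] E)
    (hg : Function.Injective g) : (mapComplex T g hg).space = g '' T.space := by
  ext x
  simp only [Geometry.SimplicialComplex.mem_space_iff, mapComplex, Set.mem_ofPred_eq,
    Set.mem_image]
  constructor
  · rintro ⟨_, ⟨t, ht, rfl⟩, hx⟩
    rw [Finset.coe_map, Function.Embedding.coeFn_mk, ← g.image_convexHull] at hx
    obtain ⟨y, hy, rfl⟩ := hx
    exact ⟨y, ⟨t, ht, hy⟩, rfl⟩
  · rintro ⟨y, ⟨t, ht, hy⟩, rfl⟩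
    refine ⟨_, ⟨t, ht, rfl⟩, ?_⟩
    rw [Finset.coe_map, Function.Embedding.coeFn_mk, ← g.image_convexHull]
    exact ⟨y, hy, rfl⟩

lemma mapComplex_vertices (T : Geometry.SimplicialComplex ℝ F) (g : F →ᵃ[ℝ] E)
    (hg : Function.Injective g) : (mapComplex T g hg).vertices = g '' T.vertices := by
  ext x
  simp only [Geometry.SimplicialComplex.mem_vertices, mapComplex, Set.mem_ofPred_eq,
    Set.mem_image]
  constructor
  · rintro ⟨t, ht, hx⟩
    obtain ⟨y, hy, hyx⟩ := Finset.mem_map.1 (hx ▸ Finset.mem_singleton_self x)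
    refine ⟨y, ?_, hyx⟩
    rwa [show ({y} : Finset F) = t from ?_]
    refine (Finset.map_injective ⟨g, hg⟩ ?_)
    rw [← hx, Finset.map_singleton, hyx]
  · rintro ⟨y, hy, rfl⟩
    exact ⟨{y}, hy, by simp⟩

end Map

/-! ### Kuhn's triangulation -/

section Kuhn

variable {ι : Type*}

/-- The integer points as vectors with real entries. -/
def intVec : (ι → ℤ) ↪ (ι → ℝ) :=
  ⟨fun z i => (z i : ℝ), fun _ _ h => funext fun i => Int.cast_injective (congrFun h i)⟩

@[simp] lemma intVec_apply (z : ι → ℤ) (i : ι) : intVec z i = z i := rfl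

/-- The integer points in `t` form a chain inside a translate of the unit cube. -/
def IsCubeChain (t : Finset (ι → ℤ)) : Prop :=
  ∀ u ∈ t, ∀ v ∈ t, (u ≤ v ∨ v ≤ u) ∧ ∀ i, u i ≤ v i + 1

lemma IsCubeChain.mono {s t : Finset (ι → ℤ)} (ht : IsCubeChain t) (h : s ⊆ t) : IsCubeChain s :=
  fun u hu v hv => ht u (h hu) v (h hv)

open Classical in
/-- The total weight of the points of a chain above `v` is determined by the weighted sum. -/
lemma IsCubeChain.le_sum_filter_iff {t : Finset (ι → ℤ)} (ht : IsCubeChain t) {w : (ι → ℤ) → ℝ}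
    (hw : ∀ u, 0 ≤ w u) (v : ι → ℤ) {θ : ℝ} (hθ : 0 < θ) :
    θ ≤ ∑ u ∈ t with v ≤ u, w u ↔
      θ ≤ ∑ u ∈ t, w u ∧
        ∀ i, θ ≤ ∑ u ∈ t, w u * (u i : ℝ) - (∑ u ∈ t, w u) * ((v i : ℝ) - 1) := by
  -- The lemma says that the weight above `v` is the positive part of the infimum of the total
  -- weight and these sums. Positive thresholds `θ` express this without forming an infimum over
  -- `ι`.
  have hsub : ∀ i, ∑ u ∈ t, w u * (u i : ℝ) - (∑ u ∈ t, w u) * ((v i : ℝ) - 1) =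
      ∑ u ∈ t, w u * ((u i : ℝ) - v i + 1) := by
    intro i
    rw [Finset.sum_mul, ← Finset.sum_sub_distrib]
    exact Finset.sum_congr rfl fun u _ => by ring
  simp only [hsub]
  constructor
  · intro h
    refine ⟨h.trans (Finset.sum_le_sum_of_subset_of_nonneg (Finset.filter_subset _ _)
      fun u _ _ => hw u), fun i => h.trans ?_⟩
    -- A single point above `v` forces `u i ≥ v i - 1` for all points of the chain, so no term is
    -- negative.
    obtain ⟨u₀, hu₀⟩ : (t.filter fun u => v ≤ u).Nonempty := by
      by_contra hne
      rw [Finset.not_nonempty_iff_eq_empty] at hne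
      rw [hne, Finset.sum_empty] at h
      exact absurd h hθ.not_ge
    rw [Finset.mem_filter] at hu₀
    rw [Finset.sum_filter]
    refine Finset.sum_le_sum fun u hu => ?_
    split_ifs with hvu
    · have : (v i : ℝ) ≤ u i := by exact_mod_cast hvu i
      nlinarith [hw u]
    · have h1 : (u₀ i : ℝ) ≤ u i + 1 := by exact_mod_cast (ht u₀ hu₀.1 u hu).2 i
      have h2 : (v i : ℝ) ≤ u₀ i := by exact_mod_cast hu₀.2 i
      exact mul_nonneg (hw u) (by linarith)
  · rintro ⟨h1, h2⟩
    rcases (t.filter fun u => ¬ v ≤ u).eq_empty_or_nonempty with he | hne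
    · rwa [Finset.filter_true_of_mem fun u hu => not_not.1 (Finset.filter_eq_empty_iff.1 he hu)]
    -- Take the largest point of the chain not above `v`, and a coordinate `i` in which it falls
    -- short. Points not above `v` are below `m` and contribute at most 0; points above `v` satisfy
    -- `u i ≤ m i + 1 ≤ v i` and contribute at most their weight.
    obtain ⟨m, hm⟩ := Finset.exists_maximal hne
    have hmt := Finset.mem_filter.1 hm.1
    obtain ⟨i, hi⟩ : ∃ i, ¬ v i ≤ m i := by simpa [Pi.le_def] using hmt.2
    refine (h2 i).trans ?_
    rw [Finset.sum_filter]
    refine Finset.sum_le_sum fun u hu => ?_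
    have hmv : (m i : ℝ) + 1 ≤ v i := by exact_mod_cast not_le.1 hi
    split_ifs with hvu
    · have : (u i : ℝ) ≤ m i + 1 := by exact_mod_cast (ht u hu m hmt.1).2 i
      nlinarith [hw u]
    · have hum : u ≤ m := by
        rcases (ht u hu m hmt.1).1 with h | h
        · exact h
        · exact hm.2 (Finset.mem_filter.2 ⟨hu, hvu⟩) h
      have : (u i : ℝ) ≤ m i := by exact_mod_cast hum i
      exact mul_nonpos_of_nonneg_of_nonpos (hw u) (by linarith)

/-- A vector has at most one representation as a weighted sum over a chain in a unit cube. -/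
lemma IsCubeChain.weights_unique {t t' : Finset (ι → ℤ)} (ht : IsCubeChain t)
    (ht' : IsCubeChain t') {w w' : (ι → ℤ) → ℝ} (hw : ∀ u, 0 ≤ w u) (hw' : ∀ u, 0 ≤ w' u)
    (hwt : ∀ u, w u ≠ 0 → u ∈ t) (hwt' : ∀ u, w' u ≠ 0 → u ∈ t')
    (hsum : ∑ u ∈ t, w u = ∑ u ∈ t', w' u)
    (hcomb : ∀ i, ∑ u ∈ t, w u * (u i : ℝ) = ∑ u ∈ t', w' u * (u i : ℝ)) : w = w' := by
  classical
  have hU : ∀ v, ∑ u ∈ t with v ≤ u, w u = ∑ u ∈ t' with v ≤ u, w' u := by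
    intro v
    have hiff : ∀ θ : ℝ, 0 < θ →
        (θ ≤ ∑ u ∈ t with v ≤ u, w u ↔ θ ≤ ∑ u ∈ t' with v ≤ u, w' u) := fun θ hθ => by
      rw [ht.le_sum_filter_iff hw v hθ, ht'.le_sum_filter_iff hw' v hθ, hsum]
      simp only [hcomb]
    refine le_antisymm ?_ ?_
    · rcases (Finset.sum_nonneg fun u _ => hw u :
        0 ≤ ∑ u ∈ t with v ≤ u, w u).eq_or_lt with h | h
      · rw [← h]
        exact Finset.sum_nonneg fun u _ => hw' u
      · exact (hiff _ h).1 le_rfl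
    · rcases (Finset.sum_nonneg fun u _ => hw' u :
        0 ≤ ∑ u ∈ t' with v ≤ u, w' u).eq_or_lt with h | h
      · rw [← h]
        exact Finset.sum_nonneg fun u _ => hw u
      · exact (hiff _ h).2 le_rfl
  have hext : ∀ (s : Finset (ι → ℤ)) (f : (ι → ℤ) → ℝ), (∀ u, f u ≠ 0 → u ∈ s) → s ⊆ t ∪ t' →
      ∀ v, ∑ u ∈ s with v ≤ u, f u = ∑ u ∈ t ∪ t' with v ≤ u, f u := by
    intro s f hf hs v
    refine Finset.sum_subset (Finset.filter_subset_filter _ hs) fun u hu hu' => ?_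
    by_contra h
    exact hu' (Finset.mem_filter.2 ⟨hf u h, (Finset.mem_filter.1 hu).2⟩)
  have hd : ∀ v, ∑ u ∈ t ∪ t' with v ≤ u, (w u - w' u) = 0 := by
    intro v
    rw [Finset.sum_sub_distrib, ← hext t w hwt Finset.subset_union_left,
      ← hext t' w' hwt' Finset.subset_union_right, hU, sub_self]
  by_contra hne
  have hnonempty : ((t ∪ t').filter fun u => w u - w' u ≠ 0).Nonempty := by
    obtain ⟨u, hu⟩ := Function.ne_iff.1 hne
    refine ⟨u, Finset.mem_filter.2 ⟨?_, sub_ne_zero.2 hu⟩⟩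
    rw [Finset.mem_union]
    by_cases h : w u = 0
    · exact Or.inr (hwt' u fun h' => hu (h.trans h'.symm))
    · exact Or.inl (hwt u h)
  -- At a maximal point where the weights differ, the sum of differences over the points above it
  -- reduces to one nonzero term.
  obtain ⟨m, hm⟩ := Finset.exists_maximal hnonempty
  have hmm := Finset.mem_filter.1 hm.1
  refine hmm.2 ((Finset.sum_eq_single_of_mem (f := fun u => w u - w' u) m
    (Finset.mem_filter.2 ⟨hmm.1, le_rfl⟩) fun u hu hum => ?_).symm.trans (hd m))
  by_contra h
  have hu' := Finset.mem_filter.1 hu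
  exact hum (le_antisymm (hm.2 (Finset.mem_filter.2 ⟨hu'.1, h⟩) hu'.2) hu'.2)

lemma mem_convexHull_map_intVec {t : Finset (ι → ℤ)} {x : ι → ℝ}
    (hx : x ∈ convexHull ℝ ((t.map intVec : Finset (ι → ℝ)) : Set (ι → ℝ))) :
    ∃ w : (ι → ℤ) → ℝ, (∀ u, 0 ≤ w u) ∧ (∀ u, w u ≠ 0 → u ∈ t) ∧ ∑ u ∈ t, w u = 1 ∧
      ∀ i, ∑ u ∈ t, w u * (u i : ℝ) = x i := by
  classical
  obtain ⟨c, hc0, hc1, hcx⟩ := Finset.mem_convexHull'.1 hx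
  simp only [Finset.sum_map] at hc1 hcx
  refine ⟨fun u => if u ∈ t then c (intVec u) else 0, fun u => ?_, fun u hu => ?_, ?_, fun i => ?_⟩
  · dsimp only
    split_ifs with h
    · exact hc0 _ (Finset.mem_map_of_mem _ h)
    · exact le_rfl
  · by_contra h
    exact hu (if_neg h)
  · rw [← hc1]
    exact Finset.sum_congr rfl fun u hu => if_pos hu
  · rw [← hcx, Finset.sum_apply]
    exact Finset.sum_congr rfl fun u hu => by simp [hu]

/-- The positive and negative parts of an affine dependence are two nonnegative weightings with
equal totals and equal weighted sums, hence coincide. Their total need not be 1, which is why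
`weights_unique` allows any total. -/
lemma IsCubeChain.affineIndependent {t : Finset (ι → ℤ)} (ht : IsCubeChain t) :
    AffineIndependent ℝ fun u : t => intVec (u : ι → ℤ) := by
  classical
  rw [affineIndependent_iff]
  intro s d hd0 hdc e he
  set D : (ι → ℤ) → ℝ := fun u => if h : ∃ h : u ∈ t, (⟨u, h⟩ : t) ∈ s then d ⟨u, h.choose⟩ else 0
    with hD
  have hDs : ∀ u : t, u ∈ s → D u = d u := fun u hu => dif_pos ⟨u.2, hu⟩
  have hDt : ∀ u, D u ≠ 0 → u ∈ t := by
    intro u hu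
    by_contra h
    exact hu (dif_neg fun h' => h h'.choose)
  have hsum : ∀ f : (ι → ℤ) → ℝ, ∑ u ∈ t, D u * f u = ∑ u ∈ s, d u * f u := by
    intro f
    rw [← Finset.sum_coe_sort t fun u => D u * f u]
    symm
    rw [Finset.sum_congr rfl fun u hu => by rw [← hDs u hu]]
    refine Finset.sum_subset (Finset.subset_univ _) fun u _ hu => ?_
    have : D u = 0 := dif_neg fun h => hu h.choose_spec
    rw [this, zero_mul]
  have h1 : ∑ u ∈ t, D u = 0 := by simpa [hd0] using hsum fun _ => 1
  have h2 : ∀ i, ∑ u ∈ t, D u * (u i : ℝ) = 0 := by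
    intro i
    rw [hsum fun u => (u i : ℝ)]
    simpa using congrFun hdc i
  have hpm : ∀ u, max (D u) 0 - max (-D u) 0 = D u := fun u => max_zero_sub_max_neg_zero_eq_self _
  have key := ht.weights_unique ht (w := fun u => max (D u) 0) (w' := fun u => max (-D u) 0)
    (fun u => le_max_right _ _) (fun u => le_max_right _ _)
    (fun u hu => hDt u fun h => hu (by simp [h])) (fun u hu => hDt u fun h => hu (by simp [h]))
    (by rw [← sub_eq_zero, ← Finset.sum_sub_distrib]; simpa only [hpm] using h1)
    (fun i => by
      rw [← sub_eq_zero, ← Finset.sum_sub_distrib]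
      simpa only [← sub_mul, hpm] using h2 i)
  rw [← hDs e he, ← hpm e, sub_eq_zero]
  exact congrFun key e

/-- Kuhn's triangulation, restricted to the simplices with vertices in `Z`. -/
def kuhnComplex (Z : Set (ι → ℤ)) : Geometry.SimplicialComplex ℝ (ι → ℝ) where
  faces := {s | s.Nonempty ∧ ∃ t : Finset (ι → ℤ), (t : Set (ι → ℤ)) ⊆ Z ∧ IsCubeChain t ∧
    s = t.map intVec}
  isRelLowerSet_faces := by
    classical
    rintro _ ⟨hne, t, htZ, ht, rfl⟩
    refine ⟨hne, fun s hs hne' => ⟨hne', ?_⟩⟩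
    obtain ⟨u, hu, rfl⟩ := Finset.subset_map_iff.1 hs
    exact ⟨u, (Finset.coe_subset.2 hu).trans htZ, ht.mono hu, rfl⟩
  indep := by
    rintro _ ⟨-, t, -, ht, rfl⟩
    exact affineIndependent_finset_map ht.affineIndependent
  inter_subset_convexHull := by
    classical
    rintro _ _ ⟨-, t, -, ht, rfl⟩ ⟨-, t', -, ht', rfl⟩ x ⟨hx, hx'⟩
    obtain ⟨w, hw0, hwt, hw1, hwx⟩ := mem_convexHull_map_intVec hx
    obtain ⟨w', hw0', hwt', hw1', hwx'⟩ := mem_convexHull_map_intVec hx'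
    obtain rfl : w = w' := ht.weights_unique ht' hw0 hw0' hwt hwt' (hw1.trans hw1'.symm)
      fun i => (hwx i).trans (hwx' i).symm
    -- By uniqueness the weights for the two simplices agree, so they are supported on common
    -- vertices.
    have hxeq : x = ∑ u ∈ t with w u ≠ 0, w u • intVec u := by
      rw [Finset.sum_filter_of_ne (p := fun u => w u ≠ 0) fun u _ h h' => h (by rw [h', zero_smul])]
      funext i
      rw [← hwx i, Finset.sum_apply]
      exact Finset.sum_congr rfl fun u _ => rfl
    rw [hxeq]
    refine (convex_convexHull ℝ _).sum_mem (fun u _ => hw0 u)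
      (by rw [Finset.sum_filter_ne_zero, hw1]) fun u hu => subset_convexHull ℝ _ ?_
    have hu' := (Finset.mem_filter.1 hu).2
    exact ⟨Finset.mem_coe.2 (Finset.mem_map_of_mem _ (hwt u hu')),
      Finset.mem_coe.2 (Finset.mem_map_of_mem _ (hwt' u hu'))⟩

lemma floor_add_eq (a : ℝ) {θ : ℝ} (hθ : θ ∈ Set.Ico (0 : ℝ) 1) :
    (⌊a + θ⌋ : ℝ) = ⌊a⌋ + (Set.Ici (1 - Int.fract a)).indicator (fun _ => (1 : ℝ)) θ := by
  have h1 := Int.fract_nonneg a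
  have h2 := Int.fract_lt_one a
  have h3 := Int.floor_add_fract a
  obtain ⟨h4, h5⟩ := hθ
  by_cases h : θ ∈ Set.Ici (1 - Int.fract a)
  · rw [Set.indicator_of_mem h]
    rw [Set.mem_Ici] at h
    have : ⌊a + θ⌋ = ⌊a⌋ + 1 := by
      rw [Int.floor_eq_iff]
      push_cast
      constructor <;> linarith
    rw [this]
    push_cast
    rfl
  · rw [Set.indicator_of_notMem h, add_zero]
    rw [Set.mem_Ici, not_le] at h
    have : ⌊a + θ⌋ = ⌊a⌋ := by
      rw [Int.floor_eq_iff]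
      constructor <;> linarith
    rw [this]

lemma integrableOn_floor_add (a : ℝ) :
    IntegrableOn (fun θ : ℝ => (⌊a + θ⌋ : ℝ)) (Set.Ico 0 1) := by
  rw [integrableOn_congr_fun (fun θ hθ => floor_add_eq a hθ) measurableSet_Ico]
  exact (integrable_const _).add ((integrable_const _).indicator measurableSet_Ici)

/-- Rounding with a uniform offset is unbiased: it rounds up with probability equal to the
fractional part. -/
lemma integral_floor_add (a : ℝ) : ∫ θ in Set.Ico (0 : ℝ) 1, (⌊a + θ⌋ : ℝ) = a := by
  rw [setIntegral_congr_fun measurableSet_Ico fun θ hθ => floor_add_eq a hθ,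
    integral_add (integrable_const _) ((integrable_const _).indicator measurableSet_Ici),
    setIntegral_indicator measurableSet_Ici]
  have : Set.Ico (0 : ℝ) 1 ∩ Set.Ici (1 - Int.fract a) = Set.Ico (1 - Int.fract a) 1 := by
    ext θ
    simp only [Set.mem_inter_iff, Set.mem_Ico, Set.mem_Ici]
    have := Int.fract_lt_one a
    constructor
    · rintro ⟨⟨h1, h2⟩, h3⟩
      exact ⟨h3, h2⟩
    · rintro ⟨h1, h2⟩
      exact ⟨⟨by linarith, h2⟩, h1⟩
  rw [this]
  simp [Int.fract_nonneg, Int.floor_add_fract]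

variable [Fintype ι]

/-- The integer points `⌊x + θ⌋` with `0 ≤ θ < 1` form a chain whose convex hull contains `x`. -/
lemma exists_isCubeChain_mem_convexHull (x : ι → ℝ) :
    ∃ t : Finset (ι → ℤ), IsCubeChain t ∧
      (∀ u ∈ t, ∃ θ ∈ Set.Ico (0 : ℝ) 1, u = fun i => ⌊x i + θ⌋) ∧
      x ∈ convexHull ℝ ((t.map intVec : Finset (ι → ℝ)) : Set (ι → ℝ)) := by
  classical
  have hfin : ((fun θ : ℝ => fun i => ⌊x i + θ⌋) '' Set.Ico (0 : ℝ) 1).Finite := by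
    refine (Set.finite_Icc (fun i => ⌊x i⌋) (fun i => ⌊x i⌋ + 1)).subset ?_
    rintro _ ⟨θ, ⟨h0, h1⟩, rfl⟩
    refine ⟨fun i => Int.floor_mono (by linarith), fun i => ?_⟩
    dsimp only
    rw [← Int.floor_add_one]
    exact Int.floor_mono (by linarith)
  refine ⟨hfin.toFinset, ?_, ?_, ?_⟩
  · intro u hu v hv
    rw [Set.Finite.mem_toFinset] at hu hv
    obtain ⟨θ, ⟨h0, h1⟩, rfl⟩ := hu
    obtain ⟨θ', ⟨h0', h1'⟩, rfl⟩ := hv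
    refine ⟨?_, fun i => ?_⟩
    · rcases le_total θ θ' with h | h
      · exact Or.inl fun i => Int.floor_mono (by linarith)
      · exact Or.inr fun i => Int.floor_mono (by linarith)
    · dsimp only
      rw [← Int.floor_add_one]
      exact Int.floor_mono (by linarith)
  · intro u hu
    rw [Set.Finite.mem_toFinset] at hu
    obtain ⟨θ, hθ, rfl⟩ := hu
    exact ⟨θ, hθ, rfl⟩
  -- `x` is the mean of its random rounding, whose values form a finite set; the hull of that set is
  -- closed and convex, so it contains the mean.
  · have hprob : IsProbabilityMeasure ((volume : Measure ℝ).restrict (Set.Ico 0 1)) :=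
      ⟨by simp⟩
    have hint : Integrable (fun θ : ℝ => intVec fun i => ⌊x i + θ⌋)
        ((volume : Measure ℝ).restrict (Set.Ico 0 1)) :=
      Integrable.of_eval fun i => integrableOn_floor_add (x i)
    have hx : ∫ θ in Set.Ico (0 : ℝ) 1, intVec (fun i => ⌊x i + θ⌋) = x := by
      funext i
      rw [eval_integral (f := fun θ => intVec fun i => ⌊x i + θ⌋)
        fun i => integrableOn_floor_add (x i)]
      exact integral_floor_add (x i)
    have hmem := (convex_convexHull ℝ
      ((hfin.toFinset.map intVec : Finset (ι → ℝ)) : Set (ι → ℝ))).integral_mem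
      ((hfin.toFinset.map intVec).finite_toSet.isClosed_convexHull ℝ)
      (μ := (volume : Measure ℝ).restrict (Set.Ico 0 1))
      (f := fun θ => intVec fun i => ⌊x i + θ⌋) ?_ hint
    · rwa [hx] at hmem
    · refine (ae_restrict_iff' measurableSet_Ico).2 (ae_of_all _ fun θ hθ => ?_)
      refine subset_convexHull ℝ _ (Finset.mem_coe.2 (Finset.mem_map_of_mem _ ?_))
      rw [Set.Finite.mem_toFinset]
      exact ⟨θ, hθ, rfl⟩

/-- Kuhn's triangulation of a convex set that is stable under the roundings `x ↦ ⌊x + θ⌋`. -/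
theorem exists_kuhn_triangulation {D : Set (ι → ℝ)} (hD : Convex ℝ D)
    (hround : ∀ x ∈ D, ∀ θ ∈ Set.Ico (0 : ℝ) 1, intVec (fun i => ⌊x i + θ⌋) ∈ D) :
    ∃ T : Geometry.SimplicialComplex ℝ (ι → ℝ), T.space = D ∧
      T.vertices = {x ∈ D | ∃ z, intVec z = x} ∧
      ∀ s ∈ T.faces, ∀ x ∈ s, ∀ y ∈ s,
        (∀ i, x i ≤ y i ∧ y i ≤ x i + 1) ∨ ∀ i, y i ≤ x i ∧ x i ≤ y i + 1 := by
  refine ⟨kuhnComplex {z | intVec z ∈ D}, ?_, ?_, ?_⟩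
  · ext x
    rw [Geometry.SimplicialComplex.mem_space_iff]
    constructor
    · rintro ⟨_, ⟨-, t, htZ, -, rfl⟩, hx⟩
      refine convexHull_min ?_ hD hx
      intro y hy
      obtain ⟨z, hz, rfl⟩ := Finset.mem_map.1 (Finset.mem_coe.1 hy)
      exact htZ hz
    · intro hx
      obtain ⟨t, ht, htx, hxt⟩ := exists_isCubeChain_mem_convexHull x
      refine ⟨_, ⟨Finset.coe_nonempty.1 (convexHull_nonempty_iff.1 ⟨x, hxt⟩), t, ?_, ht, rfl⟩, hxt⟩
      intro u hu
      obtain ⟨θ, hθ, rfl⟩ := htx u hu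
      exact hround x hx θ hθ
  · ext x
    constructor
    · rintro ⟨-, t, htZ, -, hx⟩
      obtain ⟨z, hz, rfl⟩ := Finset.mem_map.1 (hx ▸ Finset.mem_singleton_self x)
      exact ⟨htZ hz, z, rfl⟩
    · rintro ⟨hx, z, rfl⟩
      refine ⟨Finset.singleton_nonempty _, {z}, by simpa using hx, ?_, by simp⟩
      intro u hu v hv
      rw [Finset.mem_singleton] at hu hv
      subst hu hv
      exact ⟨Or.inl le_rfl, fun i => by simp⟩
  · rintro _ ⟨-, t, -, ht, rfl⟩ x hx y hy
    obtain ⟨u, hu, rfl⟩ := Finset.mem_map.1 hx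
    obtain ⟨v, hv, rfl⟩ := Finset.mem_map.1 hy
    refine (ht u hu v hv).1.imp (fun h i => ⟨?_, ?_⟩) fun h i => ⟨?_, ?_⟩
    · simp only [intVec_apply]
      exact_mod_cast h i
    · simp only [intVec_apply]
      exact_mod_cast (ht v hv u hu).2 i
    · simp only [intVec_apply]
      exact_mod_cast h i
    · simp only [intVec_apply]
      exact_mod_cast (ht u hu v hv).2 i

end Kuhn

/-! ### Triangulations of the forecast spaces -/

section Forecasts

lemma exists_triangulation_image {ι E : Type*} [Fintype ι] [NormedAddCommGroup E]
    [InnerProductSpace ℝ E] {D : Set (ι → ℝ)} (hD : Convex ℝ D)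
    (hround : ∀ x ∈ D, ∀ θ ∈ Set.Ico (0 : ℝ) 1, intVec (fun i => ⌊x i + θ⌋) ∈ D)
    (g : (ι → ℝ) →ᵃ[ℝ] E) (hg : Function.Injective g) {ε : ℝ}
    (hε : ∀ x y : ι → ℝ, (∀ i, x i ≤ y i ∧ y i ≤ x i + 1) → dist (g x) (g y) < ε) :
    ∃ T : Geometry.SimplicialComplex ℝ E, T.space = g '' D ∧
      T.vertices = g '' {x ∈ D | ∃ z, intVec z = x} ∧ MeshLT T ε := by
  obtain ⟨T, hT, hTv, hTm⟩ := exists_kuhn_triangulation hD hround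
  refine ⟨mapComplex T g hg, by rw [mapComplex_space, hT], by rw [mapComplex_vertices, hTv], ?_⟩
  rintro _ ⟨s, hs, rfl⟩ f₁ hf₁ f₂ hf₂
  -- Distances in a simplex are dominated by distances between its vertices, which are images of
  -- comparable points of one unit cube.
  obtain ⟨v₁, hv₁, v₂, hv₂, hle⟩ := convexHull_exists_dist_ge2 hf₁ hf₂
  refine hle.trans_lt ?_
  obtain ⟨x, hx, rfl⟩ := Finset.mem_map.1 (Finset.mem_coe.1 hv₁)
  obtain ⟨y, hy, rfl⟩ := Finset.mem_map.1 (Finset.mem_coe.1 hv₂)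
  rcases hTm s hs x hx y hy with h | h
  · exact hε x y h
  · rw [dist_comm]
    exact hε y x h

/-! #### Moments -/

/-- The affine map from grid coordinates to moments. -/
noncomputable def momentMap (B : ℝ) (M : ℕ) : (Fin 2 → ℝ) →ᵃ[ℝ] EuclideanSpace ℝ (Fin 2) where
  toFun x := !₂[-B + 2 * B * (x 0 / M), B ^ 2 * (x 1 / M)]
  linear :=
    { toFun := fun x => !₂[2 * B * (x 0 / M), B ^ 2 * (x 1 / M)]
      map_add' := fun x y => by
        ext i
        fin_cases i <;> simp <;> ring
      map_smul' := fun c x => by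
        ext i
        fin_cases i <;> simp <;> ring }
  map_vadd' x y := by
    ext i
    fin_cases i <;> simp <;> ring

lemma momentMap_zero (B : ℝ) (M : ℕ) (x : Fin 2 → ℝ) :
    momentMap B M x 0 = -B + 2 * B * (x 0 / M) := rfl

lemma momentMap_one (B : ℝ) (M : ℕ) (x : Fin 2 → ℝ) :
    momentMap B M x 1 = B ^ 2 * (x 1 / M) := rfl

lemma momentMap_injective {B : ℝ} (hB : 0 < B) {M : ℕ} (hM : 0 < M) :
    Function.Injective (momentMap B M) := by
  intro x y h
  have hM' : (0 : ℝ) < M := by exact_mod_cast hM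
  have h0 := congrArg (fun f : EuclideanSpace ℝ (Fin 2) => f 0) h
  have h1 := congrArg (fun f : EuclideanSpace ℝ (Fin 2) => f 1) h
  simp only [momentMap_zero, momentMap_one] at h0 h1
  funext i
  fin_cases i
  · simpa [hB.ne', hM'.ne'] using h0
  · simpa [hB.ne', hM'.ne'] using h1

lemma momentMap_image_box {B : ℝ} (hB : 0 < B) {M : ℕ} (hM : 0 < M) :
    momentMap B M '' {x | ∀ i, x i ∈ Set.Icc (0 : ℝ) M} = momentBox B := by
  have hM' : (0 : ℝ) < M := by exact_mod_cast hM
  have hB2 : 0 < B ^ 2 := by positivity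
  ext f
  constructor
  · rintro ⟨x, hx, rfl⟩
    have hq : ∀ i, 0 ≤ x i / M ∧ x i / M ≤ 1 := fun i =>
      ⟨div_nonneg (hx i).1 hM'.le, (div_le_one hM').2 (hx i).2⟩
    refine ⟨?_, ?_⟩
    · rw [momentMap_zero]
      constructor <;> nlinarith [(hq 0).1, (hq 0).2]
    · rw [momentMap_one]
      constructor <;> nlinarith [(hq 1).1, (hq 1).2]
  · rintro ⟨⟨h1, h2⟩, h3, h4⟩
    refine ⟨![(f 0 + B) / (2 * B) * M, f 1 / B ^ 2 * M], ?_, ?_⟩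
    · intro i
      fin_cases i
      · simp only [Fin.zero_eta, Matrix.cons_val_zero]
        refine ⟨by have : 0 ≤ f 0 + B := by linarith
                   positivity, ?_⟩
        have : (f 0 + B) / (2 * B) ≤ 1 := by
          rw [div_le_one (by positivity)]
          linarith
        nlinarith
      · simp only [Fin.mk_one, Matrix.cons_val_one, Matrix.cons_val_fin_one]
        refine ⟨by positivity, ?_⟩
        have : f 1 / B ^ 2 ≤ 1 := by
          rw [div_le_one (by positivity)]
          linarith
        nlinarith
    · ext i
      fin_cases i
      · simp only [Fin.zero_eta, momentMap_zero, Matrix.cons_val_zero]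
        field_simp
        ring
      · simp only [Fin.mk_one, momentMap_one, Matrix.cons_val_one, Matrix.cons_val_fin_one]
        field_simp

lemma momentMap_image_grid {B : ℝ} {M : ℕ} :
    momentMap B M '' {x ∈ {x : Fin 2 → ℝ | ∀ i, x i ∈ Set.Icc (0 : ℝ) M} | ∃ z, intVec z = x} =
      momentGrid B M := by
  ext f
  constructor
  · rintro ⟨_, ⟨hx, z, rfl⟩, rfl⟩
    simp only [Set.mem_ofPred_eq, intVec_apply] at hx
    have hz : ∀ i, ∃ k : Fin (M + 1), (z i : ℝ) = (k : ℕ) := by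
      intro i
      have h1 : 0 ≤ z i := by exact_mod_cast (hx i).1
      have h2 : z i ≤ M := by exact_mod_cast (hx i).2
      refine ⟨⟨(z i).toNat, by omega⟩, ?_⟩
      have : ((z i).toNat : ℤ) = z i := Int.toNat_of_nonneg h1
      exact_mod_cast this.symm
    obtain ⟨k, hk⟩ := hz 0
    obtain ⟨l, hl⟩ := hz 1
    exact ⟨k, l, by rw [momentMap_zero, intVec_apply, hk], by rw [momentMap_one, intVec_apply, hl]⟩
  · rintro ⟨k, l, hk, hl⟩
    refine ⟨intVec ![(k : ℕ), (l : ℕ)], ⟨fun i => ?_, _, rfl⟩, ?_⟩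
    · have hk' : ((k : ℕ) : ℝ) ≤ M := by exact_mod_cast Nat.lt_succ_iff.1 k.2
      have hl' : ((l : ℕ) : ℝ) ≤ M := by exact_mod_cast Nat.lt_succ_iff.1 l.2
      fin_cases i
      · simpa using hk'
      · simpa using hl'
    · ext i
      fin_cases i
      · simp [momentMap_zero, hk]
      · simp [momentMap_one, hl]

lemma exists_moment_triangulation {B ε : ℝ} (hB : 0 < B) {M : ℕ} (hM : 0 < M)
    (hε : Real.sqrt ((2 * B / M) ^ 2 + (B ^ 2 / M) ^ 2) < ε) :
    ∃ T : Geometry.SimplicialComplex ℝ (EuclideanSpace ℝ (Fin 2)),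
      T.space = momentBox B ∧ T.vertices = momentGrid B M ∧ MeshLT T ε := by
  have hconv : Convex ℝ {x : Fin 2 → ℝ | ∀ i, x i ∈ Set.Icc (0 : ℝ) M} := by
    intro x hx y hy a b ha hb hab i
    exact convex_Icc (0 : ℝ) M (hx i) (hy i) ha hb hab
  rw [← momentMap_image_box hB hM, ← momentMap_image_grid]
  refine exists_triangulation_image hconv ?_ _ (momentMap_injective hB hM) ?_
  · intro x hx θ hθ i
    rw [intVec_apply]
    have h1 : (0 : ℤ) ≤ ⌊x i + θ⌋ := Int.floor_nonneg.2 (add_nonneg (hx i).1 hθ.1)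
    have h2 : ⌊x i + θ⌋ < (M : ℤ) + 1 := by
      rw [Int.floor_lt]
      push_cast
      linarith [(hx i).2, hθ.2]
    exact ⟨by exact_mod_cast h1, by exact_mod_cast Int.lt_add_one_iff.1 h2⟩
  · intro x y hxy
    refine lt_of_le_of_lt ?_ hε
    rw [EuclideanSpace.dist_eq, Fin.sum_univ_two]
    refine Real.sqrt_le_sqrt (add_le_add ?_ ?_)
    · rw [momentMap_zero, momentMap_zero, Real.dist_eq, sq_abs,
        show -B + 2 * B * (x 0 / M) - (-B + 2 * B * (y 0 / M)) = 2 * B / M * (x 0 - y 0) by ring,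
        mul_pow]
      exact mul_le_of_le_one_right (sq_nonneg _)
        (by nlinarith [(hxy 0).1, (hxy 0).2])
    · rw [momentMap_one, momentMap_one, Real.dist_eq, sq_abs,
        show B ^ 2 * (x 1 / M) - B ^ 2 * (y 1 / M) = B ^ 2 / M * (x 1 - y 1) by ring, mul_pow]
      exact mul_le_of_le_one_right (sq_nonneg _)
        (by nlinarith [(hxy 1).1, (hxy 1).2])

lemma momentBox_eq_image (B : ℝ) : momentBox B =
    WithLp.toLp 2 '' Set.univ.pi ![Set.Icc (-B) B, Set.Icc 0 (B ^ 2)] := by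
  ext f
  constructor
  · rintro ⟨h0, h1⟩
    refine ⟨f.ofLp, fun i _ => ?_, rfl⟩
    fin_cases i
    · exact h0
    · exact h1
  · rintro ⟨x, hx, rfl⟩
    exact ⟨hx 0 trivial, hx 1 trivial⟩

lemma isCompact_momentBox (B : ℝ) : IsCompact (momentBox B) := by
  rw [momentBox_eq_image]
  refine (isCompact_univ_pi fun i => ?_).image (PiLp.continuous_toLp 2 _)
  fin_cases i
  · exact isCompact_Icc
  · exact isCompact_Icc

lemma convex_momentBox (B : ℝ) : Convex ℝ (momentBox B) := by
  intro x hx y hy a b ha hb hab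
  exact ⟨convex_Icc (-B) B hx.1 hy.1 ha hb hab, convex_Icc 0 (B ^ 2) hx.2 hy.2 ha hb hab⟩

lemma moments_mem_momentBox {B y : ℝ} (hy : y ∈ Set.Icc (-B) B) : moments y ∈ momentBox B :=
  ⟨hy, sq_nonneg _, sq_le_sq' hy.1 hy.2⟩

/-! #### Probability vectors -/

lemma isCompact_pmfs (n : ℕ) : IsCompact (pmfs n) := by
  have : pmfs n = WithLp.toLp 2 '' stdSimplex ℝ (Fin n) := by
    ext f
    exact ⟨fun hf => ⟨f.ofLp, hf, rfl⟩, by rintro ⟨x, hx, rfl⟩; exact hx⟩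
  rw [this]
  exact (isCompact_stdSimplex (𝕜 := ℝ) (Fin n)).image (PiLp.continuous_toLp 2 _)

lemma convex_pmfs (n : ℕ) : Convex ℝ (pmfs n) := fun x hx y hy _ _ ha hb hab =>
  convex_stdSimplex ℝ (Fin n) (x := x.ofLp) hx (y := y.ofLp) hy ha hb hab

lemma single_mem_pmfs {n : ℕ} (k : Fin n) : EuclideanSpace.single k (1 : ℝ) ∈ pmfs n := by
  refine ⟨fun j => ?_, by simp⟩
  rw [PiLp.single_apply]
  split_ifs
  · exact zero_le_one
  · exact le_rfl

/-- The map from scaled cumulative distribution functions to probability mass functions. -/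
noncomputable def pmfMap (m N : ℕ) : (Fin (m + 1) → ℝ) →ₗ[ℝ] EuclideanSpace ℝ (Fin (m + 1)) where
  toFun x := WithLp.toLp 2 fun k => (x k - Fin.cases 0 (fun j => x j.castSucc) k) / N
  map_add' x y := by
    ext k
    refine Fin.cases ?_ (fun j => ?_) k
    · simp [add_div]
    · simp
      ring
  map_smul' c x := by
    ext k
    refine Fin.cases ?_ (fun j => ?_) k
    · simp [mul_div_assoc]
    · simp
      ring

lemma pmfMap_zero (m N : ℕ) (x : Fin (m + 1) → ℝ) : pmfMap m N x 0 = x 0 / N := by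
  simp [pmfMap]

lemma pmfMap_succ (m N : ℕ) (x : Fin (m + 1) → ℝ) (j : Fin m) :
    pmfMap m N x j.succ = (x j.succ - x j.castSucc) / N := rfl

lemma sum_pmfMap (m N : ℕ) (x : Fin (m + 1) → ℝ) :
    ∑ k, pmfMap m N x k = x (Fin.last m) / N := by
  rw [Fin.sum_univ_succ, pmfMap_zero]
  simp only [pmfMap_succ]
  rw [← Finset.sum_div, Finset.sum_sub_distrib, ← add_div]
  have h1 := Fin.sum_univ_succ x
  have h2 := Fin.sum_univ_castSucc x
  congr 1
  linarith

lemma pmfMap_injective {m N : ℕ} (hN : 0 < N) : Function.Injective (pmfMap m N) := by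
  intro x y h
  have hN' : (N : ℝ) ≠ 0 := by exact_mod_cast hN.ne'
  have hk : ∀ k, pmfMap m N x k = pmfMap m N y k := fun k => by rw [h]
  funext k
  induction k using Fin.induction with
  | zero =>
    have := hk 0
    rw [pmfMap_zero, pmfMap_zero] at this
    field_simp at this
    exact this
  | succ j ih =>
    have := hk j.succ
    rw [pmfMap_succ, pmfMap_succ, ih] at this
    field_simp at this
    linarith

/-- The cumulative sums of a vector. -/
noncomputable def cumSum {m : ℕ} (f : Fin (m + 1) → ℝ) (k : Fin (m + 1)) : ℝ :=
  ∑ i, if i ≤ k then f i else 0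

lemma cumSum_zero {m : ℕ} (f : Fin (m + 1) → ℝ) : cumSum f 0 = f 0 := by
  simp [cumSum]

lemma cumSum_succ {m : ℕ} (f : Fin (m + 1) → ℝ) (j : Fin m) :
    cumSum f j.succ - cumSum f j.castSucc = f j.succ := by
  rw [cumSum, cumSum, ← Finset.sum_sub_distrib, Finset.sum_eq_single j.succ]
  · simp
  · intro i _ hi
    have : i ≤ j.succ ↔ i ≤ j.castSucc := by
      simp only [Fin.le_def, Fin.val_succ, Fin.val_castSucc]
      have : (i : ℕ) ≠ j + 1 := fun h => hi (Fin.ext h)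
      omega
    simp [this]
  · simp

lemma cumSum_last {m : ℕ} (f : Fin (m + 1) → ℝ) : cumSum f (Fin.last m) = ∑ i, f i := by
  simp [cumSum, Fin.le_last]

lemma pmfMap_cumSum {m N : ℕ} (hN : 0 < N) (f : EuclideanSpace ℝ (Fin (m + 1))) :
    pmfMap m N (cumSum fun i => N * f i) = f := by
  have hN' : (N : ℝ) ≠ 0 := by exact_mod_cast hN.ne'
  ext k
  refine Fin.cases ?_ (fun j => ?_) k
  · rw [pmfMap_zero, cumSum_zero, mul_div_cancel_left₀ _ hN']
  · rw [pmfMap_succ, cumSum_succ, mul_div_cancel_left₀ _ hN']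

/-- Scaled cumulative distribution functions with total mass `N`. -/
noncomputable def cumulative (m N : ℕ) : Set (Fin (m + 1) → ℝ) :=
  {x | 0 ≤ x 0 ∧ (∀ j : Fin m, x j.castSucc ≤ x j.succ) ∧ x (Fin.last m) = N}

lemma cumSum_mem_cumulative {m N : ℕ} {f : EuclideanSpace ℝ (Fin (m + 1))}
    (hf : f ∈ pmfs (m + 1)) : (cumSum fun i => N * f i) ∈ cumulative m N := by
  refine ⟨?_, fun j => ?_, ?_⟩
  · rw [cumSum_zero]
    exact mul_nonneg (Nat.cast_nonneg _) (hf.1 0)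
  · rw [← sub_nonneg, cumSum_succ]
    exact mul_nonneg (Nat.cast_nonneg _) (hf.1 _)
  · rw [cumSum_last, ← Finset.mul_sum, hf.2, mul_one]

lemma pmfMap_mem_pmfs {m N : ℕ} (hN : 0 < N) {x : Fin (m + 1) → ℝ} (hx : x ∈ cumulative m N) :
    pmfMap m N x ∈ pmfs (m + 1) := by
  have hN' : (0 : ℝ) < N := by exact_mod_cast hN
  refine ⟨fun k => ?_, by rw [sum_pmfMap, hx.2.2, div_self hN'.ne']⟩
  refine Fin.cases ?_ (fun j => ?_) k
  · rw [pmfMap_zero]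
    exact div_nonneg hx.1 hN'.le
  · rw [pmfMap_succ]
    exact div_nonneg (sub_nonneg.2 (hx.2.1 j)) hN'.le

lemma pmfMap_image_cumulative {m N : ℕ} (hN : 0 < N) :
    pmfMap m N '' cumulative m N = pmfs (m + 1) := by
  ext f
  constructor
  · rintro ⟨x, hx, rfl⟩
    exact pmfMap_mem_pmfs hN hx
  · exact fun hf => ⟨_, cumSum_mem_cumulative hf, pmfMap_cumSum hN f⟩

lemma pmfGrid_subset_pmfs {n N : ℕ} (hN : 0 < N) : pmfGrid n N ⊆ pmfs n := by
  rintro f ⟨k, hk, hf⟩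
  have hN' : (0 : ℝ) < N := by exact_mod_cast hN
  refine ⟨fun i => by rw [hf]; positivity, ?_⟩
  simp only [hf]
  rw [← Finset.sum_div, ← Nat.cast_sum, hk, div_self hN'.ne']

lemma pmfMap_image_grid {m N : ℕ} (hN : 0 < N) :
    pmfMap m N '' {x ∈ cumulative m N | ∃ z, intVec z = x} = pmfGrid (m + 1) N := by
  have hN' : (N : ℝ) ≠ 0 := by exact_mod_cast hN.ne'
  ext f
  constructor
  · rintro ⟨_, ⟨hx, z, rfl⟩, rfl⟩
    have hnat : ∀ k, ∃ l : ℕ, pmfMap m N (intVec z) k = (l : ℝ) / N := by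
      intro k
      refine Fin.cases ?_ (fun j => ?_) k
      · have h0 : 0 ≤ z 0 := by simpa using hx.1
        obtain ⟨l, hl⟩ := Int.eq_ofNat_of_zero_le h0
        exact ⟨l, by rw [pmfMap_zero, intVec_apply, hl]; simp⟩
      · have h0 : z j.castSucc ≤ z j.succ := by simpa using hx.2.1 j
        obtain ⟨l, hl⟩ := Int.eq_ofNat_of_zero_le (sub_nonneg.2 h0)
        refine ⟨l, ?_⟩
        rw [pmfMap_succ, intVec_apply, intVec_apply, ← Int.cast_sub, hl]
        simp
    choose l hl using hnat
    refine ⟨l, ?_, hl⟩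
    have hs := (pmfMap_mem_pmfs hN hx).2
    simp only [hl] at hs
    rw [← Finset.sum_div, div_eq_one_iff_eq hN'] at hs
    exact_mod_cast hs
  · intro hf
    refine ⟨_, ⟨cumSum_mem_cumulative (pmfGrid_subset_pmfs hN hf), ?_⟩, pmfMap_cumSum hN f⟩
    obtain ⟨l, -, hl⟩ := hf
    refine ⟨fun k => ∑ i, if i ≤ k then (l i : ℤ) else 0, ?_⟩
    funext k
    rw [intVec_apply, cumSum, Int.cast_sum]
    refine Finset.sum_congr rfl fun i _ => ?_
    rw [hl, mul_div_cancel₀ _ hN']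
    split_ifs <;> simp

/-- Rounding the entries of a probability vector would change its total. In scaled cumulative
coordinates the simplex consists of nonnegative nondecreasing sequences ending at `N`; monotonicity
of the floor and `⌊N + θ⌋ = N` make this set stable under rounding. -/
lemma exists_pmf_triangulation {n : ℕ} (hn : 0 < n) {N : ℕ} (hN : 0 < N) {ε : ℝ}
    (hε : Real.sqrt n / N < ε) :
    ∃ T : Geometry.SimplicialComplex ℝ (EuclideanSpace ℝ (Fin n)),
      T.space = pmfs n ∧ T.vertices = pmfGrid n N ∧ MeshLT T ε := by
  obtain ⟨m, rfl⟩ := Nat.exists_eq_succ_of_ne_zero hn.ne'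
  have hN' : (0 : ℝ) < N := by exact_mod_cast hN
  have hconv : Convex ℝ (cumulative m N) := by
    rintro x ⟨hx0, hx1, hx2⟩ y ⟨hy0, hy1, hy2⟩ a b ha hb hab
    refine ⟨add_nonneg (mul_nonneg ha hx0) (mul_nonneg hb hy0), fun j =>
      add_le_add (mul_le_mul_of_nonneg_left (hx1 j) ha) (mul_le_mul_of_nonneg_left (hy1 j) hb), ?_⟩
    simp only [Pi.add_apply, Pi.smul_apply, smul_eq_mul, hx2, hy2]
    rw [← add_mul, hab, one_mul]
  rw [Nat.succ_eq_add_one, ← pmfMap_image_cumulative hN, ← pmfMap_image_grid hN]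
  refine exists_triangulation_image hconv ?_ (pmfMap m N).toAffineMap (pmfMap_injective hN) ?_
  · rintro x ⟨hx0, hx1, hx2⟩ θ hθ
    refine ⟨?_, fun j => ?_, ?_⟩
    · have : (0 : ℤ) ≤ ⌊x 0 + θ⌋ := Int.floor_nonneg.2 (add_nonneg hx0 hθ.1)
      simpa using this
    · have : ⌊x j.castSucc + θ⌋ ≤ ⌊x j.succ + θ⌋ := Int.floor_mono (by linarith [hx1 j])
      simpa only [intVec_apply, Int.cast_le] using this
    · have : ⌊x (Fin.last m) + θ⌋ = N := by
        rw [hx2, Int.floor_natCast_add, Int.floor_eq_zero_iff.2 hθ, add_zero]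
      rw [intVec_apply, this]
      simp
  · intro x y hxy
    refine lt_of_le_of_lt ?_ hε
    rw [EuclideanSpace.dist_eq]
    have hk : ∀ k, dist (pmfMap m N x k) (pmfMap m N y k) ^ 2 ≤ (1 / (N : ℝ)) ^ 2 := by
      intro k
      rw [Real.dist_eq, sq_abs]
      have habs : ∀ t : ℝ, |t| ≤ 1 → (t / N) ^ 2 ≤ (1 / (N : ℝ)) ^ 2 := by
        intro t ht
        rw [div_pow, div_pow, one_pow]
        exact div_le_div_of_nonneg_right ((sq_le_one_iff_abs_le_one t).2 ht) (by positivity)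
      refine Fin.cases ?_ (fun j => ?_) k
      · rw [pmfMap_zero, pmfMap_zero, ← sub_div]
        refine habs _ (abs_le.2 ?_)
        constructor <;> linarith [(hxy 0).1, (hxy 0).2]
      · rw [pmfMap_succ, pmfMap_succ, ← sub_div]
        refine habs _ (abs_le.2 ?_)
        -- Both cumulative coordinates move by an amount in `[0, 1]` in the same direction, so their
        -- difference moves by at most 1.
        have h1 := hxy j.succ
        have h2 := hxy j.castSucc
        constructor <;> linarith [h1.1, h1.2, h2.1, h2.2]
    calc Real.sqrt (∑ k, dist (pmfMap m N x k) (pmfMap m N y k) ^ 2)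
        ≤ Real.sqrt (∑ _k : Fin (m + 1), (1 / (N : ℝ)) ^ 2) :=
          Real.sqrt_le_sqrt (Finset.sum_le_sum fun k _ => hk k)
      _ = Real.sqrt ((m + 1 : ℕ) : ℝ) / N := by
          rw [Finset.sum_const, Finset.card_univ, Fintype.card_fin, nsmul_eq_mul,
            Real.sqrt_mul (Nat.cast_nonneg _), Real.sqrt_sq (by positivity), mul_one_div]

end Forecasts

/-! ### Adaptive conformal inference -/

section Conformal

variable {Q : unitInterval → EReal} {S : Set ℝ}

lemma IsQuantileFn.cover_zero (hQ : IsQuantileFn Q S) {y : ℝ} (hy : y ∈ S) : cover Q y 0 = 0 :=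
  if_neg (hQ.2 y hy).1.not_ge

lemma IsQuantileFn.cover_one (hQ : IsQuantileFn Q S) {y : ℝ} (hy : y ∈ S) : cover Q y 1 = 1 :=
  if_pos (hQ.2 y hy).2

lemma cover_nonneg (Q : unitInterval → EReal) (y : ℝ) (a : unitInterval) : 0 ≤ cover Q y a := by
  unfold cover
  split_ifs <;> norm_num

lemma cover_le_one (Q : unitInterval → EReal) (y : ℝ) (a : unitInterval) : cover Q y a ≤ 1 := by
  unfold cover
  split_ifs <;> norm_num

lemma IsQuantileFn.cover_mono (hQ : IsQuantileFn Q S) (y : ℝ) : Monotone (cover Q y) := by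
  intro a b hab
  unfold cover
  split_ifs with h1 h2
  · exact le_rfl
  · exact absurd (h1.trans (hQ.1 hab)) h2
  · exact zero_le_one
  · exact le_rfl

variable {M : ℕ} {a : Fin (M + 1) → unitInterval} {β : ℝ}

lemma inner_aciPayoff (c : EuclideanSpace ℝ (Fin (M + 1))) (p : Fin (M + 1) → ℝ) (y : ℝ) :
    inner ℝ c (aciPayoff Q β a p y) = ∑ i, c i * (p i * (cover Q y (a i) - β)) := by
  rw [PiLp.inner_apply]
  exact Finset.sum_congr rfl fun i _ => mul_comm _ _

lemma inner_aciPayoff_single (c : EuclideanSpace ℝ (Fin (M + 1))) (k : Fin (M + 1)) (y : ℝ) :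
    inner ℝ c (aciPayoff Q β a (Pi.single k 1) y) = c k * (cover Q y (a k) - β) := by
  rw [inner_aciPayoff, Finset.sum_eq_single k]
  · simp
  · intro i _ hi
    simp [hi]
  · simp

lemma single_support_adjacent (hM : 0 < M) (k : Fin (M + 1)) :
    ∃ i : Fin M, ∀ j, (Pi.single k 1 : Fin (M + 1) → ℝ) j ≠ 0 → j = i.castSucc ∨ j = i.succ := by
  have hk : ∀ j, (Pi.single k 1 : Fin (M + 1) → ℝ) j ≠ 0 → j = k := fun j hj => by
    by_contra h
    exact hj (by simp [h])
  obtain ⟨m, rfl⟩ := Nat.exists_eq_succ_of_ne_zero hM.ne'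
  obtain h | ⟨i, h⟩ := Fin.eq_zero_or_eq_succ k
  · exact ⟨0, fun j hj => Or.inl ((hk j hj).trans h)⟩
  · exact ⟨i, fun j hj => Or.inr ((hk j hj).trans h)⟩

/-- In the cases without an ascending sign change, the half-space problem is solved exactly. -/
lemma exists_aci_exact (hM : 0 < M) (h0 : a 0 = 0) (h1 : a (Fin.last M) = 1) (ha : StrictMono a)
    (hβ : β ∈ Set.Icc (0 : ℝ) 1) {c : EuclideanSpace ℝ (Fin (M + 1))}
    (hc : (∃ i, c i = 0) ∨ (∀ i, 0 < c i) ∨ (∀ i, c i < 0) ∨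
      ∃ i : Fin M, 0 < c i.castSucc ∧ c i.succ < 0) :
    ∃ p ∈ stdSimplex ℝ (Fin (M + 1)), (∃ i : Fin M, ∀ j, p j ≠ 0 → j = i.castSucc ∨ j = i.succ) ∧
      ∀ (S : Set ℝ) (Q : unitInterval → EReal), IsQuantileFn Q S → ∀ y ∈ S,
        inner ℝ c (aciPayoff Q β a p y) ≤ 0 := by
  rcases hc with ⟨k, hk⟩ | hc | hc | ⟨i, hi, hi'⟩
  · refine ⟨Pi.single k 1, single_mem_stdSimplex ℝ k, single_support_adjacent hM k, ?_⟩
    intro S Q hQ y hy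
    rw [inner_aciPayoff_single, hk, zero_mul]
  · refine ⟨Pi.single 0 1, single_mem_stdSimplex ℝ 0, single_support_adjacent hM 0, ?_⟩
    intro S Q hQ y hy
    rw [inner_aciPayoff_single, h0, hQ.cover_zero hy]
    nlinarith [hc 0, hβ.1]
  · refine ⟨Pi.single (Fin.last M) 1, single_mem_stdSimplex ℝ _, single_support_adjacent hM _, ?_⟩
    intro S Q hQ y hy
    rw [inner_aciPayoff_single, h1, hQ.cover_one hy]
    nlinarith [hc (Fin.last M), hβ.2]
  · have hne : i.castSucc ≠ i.succ := Fin.castSucc_lt_succ.ne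
    have hd : 0 < c i.castSucc - c i.succ := by linarith
    have hs : ∀ f : Fin (M + 1) → ℝ, (∀ j, j ≠ i.castSucc ∧ j ≠ i.succ → f j = 0) →
        ∑ j, f j = f i.castSucc + f i.succ := fun f hf => Fintype.sum_eq_add _ _ hne hf
    -- The mixture balances the two terms: `c i * p i` at the two levels are opposite, so `β`
    -- cancels and the sign is that of the difference of the coverages.
    set p : Fin (M + 1) → ℝ := fun j =>
      if j = i.castSucc then -c i.succ / (c i.castSucc - c i.succ)
      else if j = i.succ then c i.castSucc / (c i.castSucc - c i.succ) else 0 with hp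
    have hp1 : p i.castSucc = -c i.succ / (c i.castSucc - c i.succ) := if_pos rfl
    have hp2 : p i.succ = c i.castSucc / (c i.castSucc - c i.succ) := by
      simp [hp, hne.symm]
    have hp3 : ∀ j, j ≠ i.castSucc ∧ j ≠ i.succ → p j = 0 := fun j hj => by
      simp [hp, hj.1, hj.2]
    have hp1' : 0 ≤ p i.castSucc := by
      rw [hp1]
      exact div_nonneg (by linarith) hd.le
    have hp2' : 0 ≤ p i.succ := by
      rw [hp2]
      exact div_nonneg hi.le hd.le
    refine ⟨p, ⟨fun j => ?_, ?_⟩, ⟨i, fun j hj => ?_⟩, ?_⟩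
    · by_cases hj1 : j = i.castSucc
      · rw [hj1]
        exact hp1'
      by_cases hj2 : j = i.succ
      · rw [hj2]
        exact hp2'
      rw [hp3 j ⟨hj1, hj2⟩]
    · rw [hs p hp3, hp1, hp2, ← add_div, neg_add_eq_sub, div_self hd.ne']
    · by_contra h
      push Not at h
      exact hj (hp3 j h)
    · intro S Q hQ y hy
      rw [inner_aciPayoff, hs _ fun j hj => by rw [hp3 j hj, zero_mul, mul_zero]]
      have hbal : c i.succ * p i.succ = -(c i.castSucc * p i.castSucc) := by
        rw [hp1, hp2]
        ring
      have hm := hQ.cover_mono y (ha.monotone (Fin.castSucc_lt_succ (i := i)).le)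
      have h2 : c i.castSucc * (p i.castSucc * (cover Q y (a i.castSucc) - β)) +
          c i.succ * (p i.succ * (cover Q y (a i.succ) - β)) =
          (c i.castSucc * p i.castSucc) * (cover Q y (a i.castSucc) - cover Q y (a i.succ)) := by
        rw [← mul_assoc (c i.succ), hbal]
        ring
      rw [h2]
      exact mul_nonpos_of_nonneg_of_nonpos (mul_nonneg hi.le hp1') (by linarith)

lemma mul_cover_sub_le_abs (hβ : β ∈ Set.Icc (0 : ℝ) 1) (c y : ℝ) (b : unitInterval) :
    c * (cover Q y b - β) ≤ |c| := by
  refine (le_abs_self _).trans ?_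
  rw [abs_mul]
  refine mul_le_of_le_one_right (abs_nonneg _) (abs_le.2 ?_)
  constructor <;> linarith [cover_nonneg Q y b, cover_le_one Q y b, hβ.1, hβ.2]

/-- Adaptive conformal inference, randomized between adjacent points of a grid. -/
theorem exists_randomized_aci (hM : 0 < M) (ha : StrictMono a) (h0 : a 0 = 0)
    (h1 : a (Fin.last M) = 1) (hβ : β ∈ Set.Icc (0 : ℝ) 1) (c : EuclideanSpace ℝ (Fin (M + 1))) :
    ∃ p ∈ stdSimplex ℝ (Fin (M + 1)),
      (∃ i : Fin M, ∀ j, p j ≠ 0 → j = i.castSucc ∨ j = i.succ) ∧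
      ∀ (S : Set ℝ) (Q : unitInterval → EReal), IsQuantileFn Q S →
        (((∃ i, c i = 0) ∨ (∀ i, 0 < c i) ∨ (∀ i, c i < 0) ∨
            ∃ i : Fin M, 0 < c i.castSucc ∧ c i.succ < 0) →
          Solves (aciPayoff Q β a) S 0 c p) ∧
        (∀ ε : ℝ, 1 / (M : ℝ) < ε →
          ∀ y ∈ S, inner ℝ c (aciPayoff Q β a p y) ≤ ε * ∑ i, |c i|) ∧
        (∀ ε : ℝ, 1 / Real.sqrt (M + 1) ≤ ε → Solves (aciPayoff Q β a) S ε c p) := by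
  have hM' : (0 : ℝ) < M := by exact_mod_cast hM
  have hsum0 : 0 ≤ ∑ i, |c i| := Finset.sum_nonneg fun i _ => abs_nonneg _
  by_cases hc : (∃ i, c i = 0) ∨ (∀ i, 0 < c i) ∨ (∀ i, c i < 0) ∨
      ∃ i : Fin M, 0 < c i.castSucc ∧ c i.succ < 0
  · obtain ⟨p, hp, hadj, hle⟩ := exists_aci_exact hM h0 h1 ha hβ hc
    refine ⟨p, hp, hadj, fun S Q hQ => ⟨fun _ y hy => ?_, fun ε hε y hy => ?_, fun ε hε y hy => ?_⟩⟩
    · rw [zero_mul]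
      exact hle S Q hQ y hy
    · exact (hle S Q hQ y hy).trans (mul_nonneg ((by positivity : 0 ≤ 1 / (M : ℝ)).trans hε.le) hsum0)
    · exact (hle S Q hQ y hy).trans
        (mul_nonneg ((by positivity : 0 ≤ 1 / Real.sqrt (M + 1)).trans hε) (norm_nonneg _))
  -- The least `|c i|` is at most the mean of the `M + 1` absolute values and at most their root
  -- mean square `‖c‖ / √(M + 1)`. These give the two radii.
  · obtain ⟨k, -, hk⟩ := Finset.exists_min_image Finset.univ (fun i => |c i|) ⟨0, Finset.mem_univ _⟩
    refine ⟨Pi.single k 1, single_mem_stdSimplex ℝ k, single_support_adjacent hM k, fun S Q hQ =>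
      ⟨fun h => absurd h hc, fun ε hε y hy => ?_, fun ε hε y hy => ?_⟩⟩
    · rw [inner_aciPayoff_single]
      refine (mul_cover_sub_le_abs hβ _ _ _).trans ?_
      have hcard : (M + 1 : ℝ) * |c k| ≤ ∑ i, |c i| := by
        have := Finset.card_nsmul_le_sum Finset.univ (fun i => |c i|) |c k| hk
        simpa using this
      have h2 : |c k| ≤ 1 / M * ∑ i, |c i| := by
        rw [one_div, inv_mul_eq_div, le_div_iff₀ hM']
        nlinarith [abs_nonneg (c k)]
      exact h2.trans (mul_le_mul_of_nonneg_right hε.le hsum0)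
    · rw [inner_aciPayoff_single]
      refine (mul_cover_sub_le_abs hβ _ _ _).trans ?_
      have hM1 : (0 : ℝ) < M + 1 := by positivity
      have hsq : (M + 1 : ℝ) * |c k| ^ 2 ≤ ‖c‖ ^ 2 := by
        rw [EuclideanSpace.norm_sq_eq]
        have := Finset.card_nsmul_le_sum Finset.univ (fun i => ‖c i‖ ^ 2) (|c k| ^ 2)
          fun i hi => by
            rw [Real.norm_eq_abs]
            exact pow_le_pow_left₀ (abs_nonneg _) (hk i hi) 2
        simpa using this
      have h2 : |c k| ≤ 1 / Real.sqrt (M + 1) * ‖c‖ := by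
        rw [one_div, inv_mul_eq_div, le_div_iff₀ (Real.sqrt_pos.2 hM1)]
        refine abs_le_of_sq_le_sq' ?_ (norm_nonneg _) |>.2
        rw [mul_pow, Real.sq_sqrt hM1.le, mul_comm]
        exact hsq
      exact h2.trans (mul_le_mul_of_nonneg_right hε (norm_nonneg _))

/-- Adaptive conformal inference with deterministic forecasts in the unit interval. -/
theorem exists_deterministic_aci (hβ : β ∈ Set.Icc (0 : ℝ) 1) {c : unitInterval → ℝ}
    (hc : Continuous c) :
    ∃ a' : unitInterval,
      (c a' = 0 ∨ ((∀ a, 0 < c a) ∧ a' = 0) ∨ ((∀ a, c a < 0) ∧ a' = 1)) ∧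
      ∀ (S : Set ℝ) (Q : unitInterval → EReal), IsQuantileFn Q S → ∀ y ∈ S,
        ∫ a, c a * (cover Q y a - β) ∂(Measure.dirac a') ≤ 0 := by
  simp only [integral_dirac]
  by_cases hroot : ∃ a', c a' = 0
  · obtain ⟨a', ha'⟩ := hroot
    exact ⟨a', Or.inl ha', fun S Q _ y _ => by rw [ha', zero_mul]⟩
  push Not at hroot
  -- Without a root, `c` has constant sign by the intermediate value theorem.
  have hsign : ∀ a b, 0 < c a → 0 < c b := by
    intro a b ha
    by_contra hb
    obtain ⟨x, hx⟩ := mem_range_of_exists_le_of_exists_ge hc ⟨b, not_lt.1 hb⟩ ⟨a, ha.le⟩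
    exact hroot x hx
  by_cases h0 : 0 < c 0
  · refine ⟨0, Or.inr (Or.inl ⟨fun b => hsign 0 b h0, rfl⟩), fun S Q hQ y hy => ?_⟩
    rw [hQ.cover_zero hy]
    nlinarith [hβ.1]
  · have hneg : ∀ b, c b < 0 := fun b =>
      lt_of_le_of_ne (not_lt.1 fun hb => h0 (hsign b 0 hb)) (hroot b)
    refine ⟨1, Or.inr (Or.inr ⟨hneg, rfl⟩), fun S Q hQ y hy => ?_⟩
    rw [hQ.cover_one hy]
    nlinarith [hβ.2, hneg 1]

end Conformal

/-! ### Quantile calibration -/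

section Quantile

open Set Filter Topology unitInterval

/-- The integral of `c` over the levels at least `τ`. -/
noncomputable def tailIntegral (c : I → ℝ) (τ : I) : ℝ := ∫ a in Ici τ, c a

lemma continuous_tailIntegral {c : I → ℝ} (hc : Integrable c) : Continuous (tailIntegral c) := by
  have : tailIntegral c = fun τ => ∫ a, (Ici τ).indicator c a := by
    funext τ
    exact (integral_indicator measurableSet_Ici).symm
  rw [this, continuous_iff_continuousAt]
  intro τ
  refine continuousAt_of_dominated (bound := fun a => ‖c a‖)
    (Eventually.of_forall fun t => hc.aestronglyMeasurable.indicator measurableSet_Ici)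
    (Eventually.of_forall fun t => Eventually.of_forall fun a => norm_indicator_le_norm_self _ _)
    hc.norm ?_
  have hne : ∀ᵐ a : I, a ≠ τ := by simp [ae_iff]
  filter_upwards [hne] with a ha
  rcases lt_or_gt_of_ne ha with h | h
  · refine continuousAt_const (y := (0 : ℝ)) |>.congr ?_
    filter_upwards [lt_mem_nhds h] with t ht
    exact (indicator_of_notMem (not_le.2 ht) c).symm
  · refine continuousAt_const (y := c a) |>.congr ?_
    filter_upwards [gt_mem_nhds h] with t ht
    exact (indicator_of_mem (show a ∈ Ici t from le_of_lt ht) c).symm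

/-- By Fubini, level `a` is counted for the thresholds `τ ≤ a`, a set of measure `a`. So the mean
tail integral is exactly the term subtracted in the calibration payoff. -/
lemma integral_tailIntegral {c : I → ℝ} (hc : Integrable c) :
    ∫ τ, tailIntegral c τ = ∫ a, c a * (a : ℝ) := by
  have h1 : ∀ τ, tailIntegral c τ = ∫ a, {p : I × I | p.1 ≤ p.2}.indicator (fun p => c p.2) (τ, a) := by
    intro τ
    rw [tailIntegral, ← integral_indicator measurableSet_Ici]
    rfl
  have hmeas : MeasurableSet {p : I × I | p.1 ≤ p.2} :=
    measurableSet_le measurable_fst measurable_snd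
  have hint : Integrable (Function.uncurry fun τ a : I =>
      {p : I × I | p.1 ≤ p.2}.indicator (fun p => c p.2) (τ, a))
      ((volume : Measure I).prod volume) :=
    (hc.comp_snd volume).indicator hmeas
  simp_rw [h1]
  rw [integral_integral_swap hint]
  congr 1
  funext a
  have : (fun τ : I => {p : I × I | p.1 ≤ p.2}.indicator (fun p => c p.2) (τ, a)) =
      (Iic a).indicator fun _ => c a := rfl
  rw [this, integral_indicator measurableSet_Iic, setIntegral_const, smul_eq_mul, mul_comm,
    measureReal_def, volume_Iic, ENNReal.toReal_ofReal a.2.1]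

lemma tailIntegral_eq_add {c : I → ℝ} (hc : Integrable c) {s t : I} (hst : s ≤ t) :
    tailIntegral c s = (∫ a in Ico s t, c a) + tailIntegral c t := by
  rw [tailIntegral, tailIntegral, ← Ico_union_Ici_eq_Ici hst]
  refine setIntegral_union ?_ measurableSet_Ici hc.integrableOn hc.integrableOn
  rw [Set.disjoint_left]
  exact fun x hx hx' => hx.2.not_ge hx'

lemma setIntegral_Ico_pos {c : I → ℝ} (hc : Integrable c) {s t : I} (hst : s < t)
    (hpos : ∀ a ∈ Ico s t, 0 < c a) : 0 < ∫ a in Ico s t, c a := by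
  rw [setIntegral_pos_iff_support_of_nonneg_ae
    ((ae_restrict_iff' measurableSet_Ico).2 (Eventually.of_forall fun a ha => (hpos a ha).le))
    hc.integrableOn]
  have : Function.support c ∩ Ico s t = Ico s t :=
    inter_eq_right.2 fun a ha => (hpos a ha).ne'
  rw [this, volume_Ico, ENNReal.ofReal_pos, sub_pos]
  exact hst

/-- First-order condition: raising the threshold across an interval where `c > 0`, or lowering it
across one where `c < 0`, would decrease the tail integral. -/
lemma eq_zero_of_isMin_tailIntegral {c : I → ℝ} (hi : Integrable c) (hc : Continuous c) {τ : I}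
    (hmin : ∀ t, tailIntegral c τ ≤ tailIntegral c t) : τ = 0 ∨ τ = 1 ∨ c τ = 0 := by
  by_contra! h
  obtain ⟨h0, h1, hcτ⟩ := h
  have hlt0 : (0 : I) < τ := lt_of_le_of_ne nonneg' h0.symm
  have hlt1 : τ < 1 := lt_of_le_of_ne le_one' h1
  rcases lt_or_gt_of_ne hcτ with hneg | hpos
  · obtain ⟨t, ht, hsub⟩ := exists_Ioc_subset_of_mem_nhds
      ((isOpen_lt hc continuous_const).mem_nhds hneg) ⟨0, hlt0⟩
    obtain ⟨s, hts, hsτ⟩ := exists_between ht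
    have h2 := setIntegral_Ico_pos hi.neg hsτ fun a ha => by
      have : c a < 0 := hsub ⟨hts.trans_le ha.1, ha.2.le⟩
      simpa using this
    have h3 := tailIntegral_eq_add hi hsτ.le
    simp only [Pi.neg_apply, integral_neg] at h2
    linarith [hmin s]
  · obtain ⟨t, ht, hsub⟩ := exists_Ico_subset_of_mem_nhds
      ((isOpen_lt continuous_const hc).mem_nhds hpos) ⟨1, hlt1⟩
    have h2 := setIntegral_Ico_pos hi ht fun a ha => hsub ha
    have h3 := tailIntegral_eq_add hi ht.le
    linarith [hmin t]

/-- Quantile calibration at all levels, by recalibration with a step function. -/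
theorem exists_stepRecal {c : I → ℝ} (hc : Integrable c) :
    ∃ τ : I, (Continuous c → τ = 0 ∨ τ = 1 ∨ c τ = 0) ∧
      ∀ (S : Set ℝ) (Q : I → EReal), IsQuantileFn Q S → ∀ y ∈ S,
        ∫ a, c a * (cover (fun b => Q (stepRecal τ b)) y a - (a : ℝ)) ≤ 0 := by
  have hcont := continuous_tailIntegral hc
  obtain ⟨τ, -, hτ⟩ := isCompact_univ.exists_isMinOn univ_nonempty hcont.continuousOn
  have hmin : ∀ t, tailIntegral c τ ≤ tailIntegral c t := fun t => hτ (mem_univ t)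
  refine ⟨τ, fun h => eq_zero_of_isMin_tailIntegral hc h hmin, fun S Q hQ y hy => ?_⟩
  -- After recalibration only the two end values of `Q` are used, so the level `a` covers `y`
  -- exactly when `a ≥ τ`, whatever `Q` and `y` are.
  have hcov : ∀ a, c a * (cover (fun b => Q (stepRecal τ b)) y a - (a : ℝ)) =
      (Ici τ).indicator c a - c a * (a : ℝ) := by
    intro a
    by_cases ha : a < τ
    · have : cover (fun b => Q (stepRecal τ b)) y a = cover Q y 0 := by
        simp [cover, stepRecal, ha]
      rw [this, hQ.cover_zero hy, indicator_of_notMem (show a ∉ Ici τ from not_le.2 ha)]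
      ring
    · have : cover (fun b => Q (stepRecal τ b)) y a = cover Q y 1 := by
        simp [cover, stepRecal, ha]
      rw [this, hQ.cover_one hy, indicator_of_mem (show a ∈ Ici τ from not_lt.1 ha)]
      ring
  have hint : Integrable fun a : I => c a * (a : ℝ) := by
    refine hc.mul_bdd (c := 1) (by fun_prop) (Eventually.of_forall fun a => ?_)
    rw [Real.norm_of_nonneg a.2.1]
    exact a.2.2
  simp_rw [hcov]
  rw [integral_sub (hc.indicator measurableSet_Ici) hint, integral_indicator measurableSet_Ici,
    ← integral_tailIntegral hc, sub_nonpos]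
  have hG : Integrable (tailIntegral c) :=
    hcont.integrable_of_hasCompactSupport (HasCompactSupport.of_compactSpace _)
  calc ∫ a in Ici τ, c a = ∫ _ : I, tailIntegral c τ := by simp [tailIntegral]
    _ ≤ ∫ t, tailIntegral c t := integral_mono (integrable_const _) hG hmin

lemma continuous_cdf_of_forall_singleton (p : Measure ℝ) [IsProbabilityMeasure p]
    (hp : ∀ x, p {x} = 0) : Continuous (ProbabilityTheory.cdf p) := by
  rw [continuous_iff_continuousAt]
  intro x
  have h := (ProbabilityTheory.cdf p).measure_singleton x
  rw [ProbabilityTheory.measure_cdf, hp, eq_comm, ENNReal.ofReal_eq_zero, sub_nonpos] at h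
  have hmono := ProbabilityTheory.monotone_cdf p
  rw [hmono.continuousAt_iff_leftLim_eq_rightLim, StieltjesFunction.rightLim_eq]
  exact le_antisymm (hmono.leftLim_le le_rfl) h

/-- There is an atomless distribution whose distribution function is constant, with any given value,
on a given interval. -/
lemma exists_continuous_cdf_eq (yMin yMax : ℝ) (s : I) :
    ∃ p : Measure ℝ, IsProbabilityMeasure p ∧ Continuous (ProbabilityTheory.cdf p) ∧
      ∀ y ∈ Icc yMin yMax, ProbabilityTheory.cdf p y = s := by
  -- Mass `s` is spread just below the interval of outcomes and mass `1 - s` just above it.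
  set p : Measure ℝ := ENNReal.ofReal s • volume.restrict (Icc (yMin - 1) yMin) +
    ENNReal.ofReal (1 - s) • volume.restrict (Ioc yMax (yMax + 1)) with hp
  have hprob : IsProbabilityMeasure p := by
    refine ⟨?_⟩
    simp only [hp, Measure.add_apply, Measure.smul_apply, Measure.restrict_apply_univ,
      Real.volume_Icc, Real.volume_Ioc, sub_sub_cancel, add_sub_cancel_left, ENNReal.ofReal_one,
      smul_eq_mul, mul_one]
    rw [← ENNReal.ofReal_add s.2.1 (sub_nonneg.2 s.2.2), add_sub_cancel, ENNReal.ofReal_one]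
  refine ⟨p, hprob, continuous_cdf_of_forall_singleton p fun x => ?_, fun y hy => ?_⟩
  · simp [hp]
  · have h1 : Iic y ∩ Icc (yMin - 1) yMin = Icc (yMin - 1) yMin :=
      inter_eq_right.2 fun x hx => hx.2.trans hy.1
    have h2 : Iic y ∩ Ioc yMax (yMax + 1) = ∅ := by
      rw [← disjoint_iff_inter_eq_empty, Set.disjoint_left]
      exact fun x hx hx' => (hx'.1.trans_le hx).not_ge hy.2
    rw [ProbabilityTheory.cdf_eq_real, measureReal_def]
    simp only [hp, Measure.add_apply, Measure.smul_apply,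
      Measure.restrict_apply measurableSet_Iic, h1, h2, measure_empty, Real.volume_Icc,
      sub_sub_cancel, ENNReal.ofReal_one, smul_eq_mul, mul_one, mul_zero, add_zero]
    exact ENNReal.toReal_ofReal s.2.1

/-- Quantile calibration at finitely many levels, by a distribution forecast. -/
theorem exists_distribution_forecast (yMin yMax : ℝ) {L : Finset ℝ}
    (hL : ∀ q ∈ L, q ∈ Icc (0 : ℝ) 1) (c : EuclideanSpace ℝ L) :
    ∃ p : Measure ℝ, IsProbabilityMeasure p ∧ Continuous (ProbabilityTheory.cdf p) ∧
      Solves (quantilePayoff L) (Icc yMin yMax) 0 c p := by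
  classical
  have hterm : ∀ q : L, Integrable fun s : I => c q * ((Iic (⟨q, hL q q.2⟩ : I)).indicator 1 s - q) :=
    fun q => (((integrable_const (1 : ℝ)).indicator measurableSet_Iic).sub
      (integrable_const _)).const_mul _
  have hzero : ∀ q : L, ∫ s : I, c q * ((Iic (⟨q, hL q q.2⟩ : I)).indicator 1 s - q) = 0 := by
    intro q
    have hind : Integrable ((Iic (⟨q, hL q q.2⟩ : I)).indicator (1 : I → ℝ)) :=
      (integrable_const (1 : ℝ)).indicator measurableSet_Iic
    rw [integral_const_mul, integral_sub hind (integrable_const _),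
      integral_indicator_one measurableSet_Iic, measureReal_def, volume_Iic,
      ENNReal.toReal_ofReal (hL q q.2).1]
    simp
  -- For uniform `s` the event `s ≤ q` has probability `q`, so the payoff in direction `c` has mean
  -- zero and some `s` makes it nonpositive.
  obtain ⟨s, hs⟩ := exists_le_integral (μ := (volume : Measure I))
    (f := fun s : I => ∑ q : L, c q * ((Iic (⟨q, hL q q.2⟩ : I)).indicator 1 s - q))
    (integrable_finsetSum _ fun q _ => hterm q)
  rw [integral_finsetSum _ fun q _ => hterm q, Finset.sum_eq_zero fun q _ => hzero q] at hs
  obtain ⟨p, hp, hcont, hcdf⟩ := exists_continuous_cdf_eq yMin yMax s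
  refine ⟨p, hp, hcont, fun y hy => ?_⟩
  rw [zero_mul, PiLp.inner_apply]
  refine le_of_eq_of_le (Finset.sum_congr rfl fun q _ => ?_) hs
  simp only [quantilePayoff, hcdf y hy, indicator_apply, mem_Iic, Pi.one_apply]
  exact mul_comm _ _

end Quantile

/-! ### Decision calibration -/

section Calibration

variable {A X Y : Type*} [Fintype A] [MeasurableSpace Y]

/-- A point mass at a minimizer of the utility in direction `c` solves the half-space problem. -/
theorem exists_solves_actionPayoff [TopologicalSpace Y] [CompactSpace Y] [Nonempty Y]
    [MeasurableSingletonClass Y] {u : A → Y → X → ℝ} {x : X}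
    (hu : ∀ a, Continuous fun y => u a y x) (c : EuclideanSpace ℝ A) :
    ∃ p : Measure Y, IsProbabilityMeasure p ∧ Solves (actionPayoff u x) Set.univ 0 c p := by
  have hcont : Continuous fun y => ∑ a, c a * u a y x :=
    continuous_finsetSum _ fun a _ => continuous_const.mul (hu a)
  obtain ⟨y₀, -, hy₀⟩ := isCompact_univ.exists_isMinOn Set.univ_nonempty hcont.continuousOn
  refine ⟨Measure.dirac y₀, inferInstance, fun y _ => ?_⟩
  have hle : ∑ a, c a * u a y₀ x ≤ ∑ a, c a * u a y x := hy₀ (Set.mem_univ y)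
  rw [zero_mul, PiLp.inner_apply]
  refine le_of_eq_of_le ?_ (sub_nonpos.2 hle)
  rw [← Finset.sum_sub_distrib]
  refine Finset.sum_congr rfl fun a _ => ?_
  simp only [actionPayoff, integral_dirac, RCLike.inner_apply, conj_trivial]
  ring

lemma inner_swapPayoff (u : A → Y → X → ℝ) (δ : Measure Y → X → A) (x : X) (p : Measure Y) (y : Y)
    (c : EuclideanSpace ℝ (A × A)) :
    inner ℝ c (swapPayoff u δ x p y) =
      ∑ a, c (a, δ p x) * (∫ y', u a y' x ∂p - u a y x) := by
  classical
  rw [PiLp.inner_apply, Fintype.sum_prod_type]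
  refine Finset.sum_congr rfl fun a _ => ?_
  rw [Finset.sum_eq_single (δ p x)]
  · simp [swapPayoff, mul_comm]
  · intro b _ hb
    simp [swapPayoff, hb]
  · simp

lemma integral_discreteForecast [MeasurableSingletonClass Y] {n : ℕ} (r : Fin n → Y)
    {f : EuclideanSpace ℝ (Fin n)} (hf : f ∈ pmfs n) (g : Y → ℝ) :
    ∫ y, g y ∂(discreteForecast r f) = ∑ k, f k * g (r k) := by
  rw [discreteForecast, integral_finsetSum_measure]
  · refine Finset.sum_congr rfl fun k _ => ?_
    rw [integral_smul_measure, integral_dirac, ENNReal.toReal_ofReal (hf.1 k), smul_eq_mul]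
  · exact fun k _ => (integrable_dirac enorm_lt_top).smul_measure ENNReal.ofReal_ne_top

/-- Expected utilities are linear in the probability vector, so swap payoffs at net outcomes are
inner products with the forecast error `v - e_k`, as the fixed-point argument requires. -/
lemma inner_swapDirection [MeasurableSingletonClass Y] {n : ℕ} (u : A → Y → X → ℝ)
    (δ : Measure Y → X → A) (x : X) (r : Fin n → Y) (c : EuclideanSpace ℝ (A × A))
    {v : EuclideanSpace ℝ (Fin n)} (hv : v ∈ pmfs n) (k : Fin n) :
    inner ℝ (swapDirection u δ x r c v) (v - EuclideanSpace.single k 1) =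
      ∑ a, c (a, δ (discreteForecast r v) x) *
        (∫ y', u a y' x ∂(discreteForecast r v) - u a (r k) x) := by
  rw [inner_sub_right, EuclideanSpace.inner_single_right, PiLp.inner_apply]
  simp only [integral_discreteForecast r hv, mul_sub, Finset.sum_sub_distrib]
  congr 1
  · simp only [swapDirection, RCLike.inner_apply, conj_trivial, Finset.mul_sum]
    rw [Finset.sum_comm]
    exact Finset.sum_congr rfl fun a _ => Finset.sum_congr rfl fun j _ => by ring
  · simp [swapDirection]

/-- A crude bound suffices: what matters is that it is uniform in `v` and `δ` and linear in `‖c‖`,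
so that the mesh `η` can be fixed before them. -/
lemma norm_swapDirection_le {n : ℕ} {u : A → Y → X → ℝ} {x : X} {U : ℝ}
    (hU : ∀ a y, |u a y x| ≤ U) (hU0 : 0 ≤ U) (δ : Measure Y → X → A) (r : Fin n → Y)
    (c : EuclideanSpace ℝ (A × A)) (v : EuclideanSpace ℝ (Fin n)) :
    ‖swapDirection u δ x r c v‖ ≤ n * (Fintype.card A * (‖c‖ * U)) := by
  have hk : ∀ k, |swapDirection u δ x r c v k| ≤ Fintype.card A * (‖c‖ * U) := by
    intro k
    refine (Finset.abs_sum_le_sum_abs _ _).trans ?_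
    refine (Finset.sum_le_card_nsmul _ _ (‖c‖ * U) fun a _ => ?_).trans_eq
      (by rw [nsmul_eq_mul, Finset.card_univ])
    rw [abs_mul]
    exact mul_le_mul (PiLp.norm_apply_le c (a, _)) (hU a _) (abs_nonneg _) (norm_nonneg _)
  set C : ℝ := Fintype.card A * (‖c‖ * U) with hC
  have hC0 : 0 ≤ C := by positivity
  refine (abs_le_of_sq_le_sq' ?_ (mul_nonneg (Nat.cast_nonneg n) hC0)).2
  rw [EuclideanSpace.norm_sq_eq]
  refine (Finset.sum_le_card_nsmul Finset.univ _ (C ^ 2) fun k _ => ?_).trans ?_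
  · rw [Real.norm_eq_abs]
    exact pow_le_pow_left₀ (abs_nonneg _) (hk k) 2
  · rw [nsmul_eq_mul, Finset.card_univ, Fintype.card_fin, mul_pow (n : ℝ) C]
    refine mul_le_mul_of_nonneg_right ?_ (sq_nonneg C)
    exact_mod_cast Nat.le_self_pow two_ne_zero n

omit [MeasurableSpace Y] in
lemma exists_finite_net [TopologicalSpace Y] [CompactSpace Y] [Nonempty Y] {u : A → Y → X → ℝ}
    {x : X} (hu : ∀ a, Continuous fun y => u a y x) {ε : ℝ} (hε : 0 < ε) :
    ∃ (n : ℕ) (r : Fin n → Y), 0 < n ∧ ∀ y, ∃ k, ∀ a, |u a (r k) x - u a y x| ≤ ε := by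
  have hcont : Continuous fun (y : Y) (a : A) => u a y x := continuous_pi hu
  obtain ⟨t, ht⟩ := CompactSpace.elim_nhds_subcover
    (fun y => (fun (z : Y) (a : A) => u a z x) ⁻¹' Metric.ball (fun a => u a y x) ε)
    fun y => hcont.continuousAt.preimage_mem_nhds (Metric.ball_mem_nhds _ hε)
  have hnet : ∀ y, ∃ k, ∀ a, |u a (t.equivFin.symm k : Y) x - u a y x| ≤ ε := by
    intro y
    have hy : y ∈ (⊤ : Set Y) := trivial
    rw [← ht] at hy
    simp only [Set.mem_iUnion, exists_prop] at hy
    obtain ⟨z, hz, hyz⟩ := hy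
    refine ⟨t.equivFin ⟨z, hz⟩, fun a => ?_⟩
    rw [Equiv.symm_apply_apply, abs_sub_comm]
    exact (dist_le_pi_dist (fun a => u a y x) (fun a => u a z x) a).trans (le_of_lt hyz)
  refine ⟨t.card, fun k => t.equivFin.symm k, ?_, hnet⟩
  obtain ⟨k, -⟩ := hnet (Classical.arbitrary Y)
  exact k.pos

omit [MeasurableSpace Y] in
lemma exists_utility_bound [TopologicalSpace Y] [CompactSpace Y] {u : A → Y → X → ℝ} {x : X}
    (hu : ∀ a, Continuous fun y => u a y x) : ∃ U : ℝ, 0 ≤ U ∧ ∀ a y, |u a y x| ≤ U := by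
  have hcont : Continuous fun (y : Y) (a : A) => u a y x := continuous_pi hu
  obtain ⟨U, hU⟩ := isCompact_univ.exists_bound_of_continuousOn hcont.continuousOn
  refine ⟨max U 0, le_max_right _ _, fun a y => ?_⟩
  exact ((norm_le_pi_norm (fun a => u a y x) a).trans (hU y trivial)).trans (le_max_left _ _)

/-- Decision calibration by the fixed-point oracle on distributions over finitely many outcomes. -/
theorem exists_decision_oracle [TopologicalSpace Y] [CompactSpace Y] [Nonempty Y]
    [MeasurableSingletonClass Y] {u : A → Y → X → ℝ} {x : X}
    (hu : ∀ a, Continuous fun y => u a y x) {ε : ℝ} (hε : 0 < ε) :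
    ∃ (n : ℕ) (r : Fin n → Y) (η : ℝ), 0 < n ∧ 0 < η ∧
      ∀ (T : Geometry.SimplicialComplex ℝ (EuclideanSpace ℝ (Fin n))) [Fintype T.vertices],
        T.space = pmfs n → MeshLT T η →
        ∀ (δ : Measure Y → X → A) (c : EuclideanSpace ℝ (A × A)),
          ∃ f : EuclideanSpace ℝ (Fin n),
            IsProjFixedPt (pmfs n) (update T fun v => swapDirection u δ x r c v) f ∧
            weight T f ∈ stdSimplex ℝ T.vertices ∧
            (∀ v v' : T.vertices, weight T f v ≠ 0 → weight T f v' ≠ 0 →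
              dist (v : EuclideanSpace ℝ (Fin n)) v' < ε) ∧
            Solves (randSwapPayoff u δ x r T) Set.univ ε c (weight T f) := by
  set N : ℝ := (Fintype.card A : ℝ) with hN
  have hN0 : 0 ≤ N := Nat.cast_nonneg _
  -- Half of `ε` pays for replacing outcomes by net points: the error is at most `N * ‖c‖` times the
  -- net accuracy. The `+ 1` avoids a zero denominator.
  obtain ⟨n, r, hn, hnet⟩ := exists_finite_net hu (ε := ε / (2 * (N + 1))) (by positivity)
  obtain ⟨U, hU0, hU⟩ := exists_utility_bound hu
  have hpos : 0 < 2 * (n * (N * U) + 1) := by positivity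
  -- The first bound keeps the played vertices within `ε` of each other; the second makes the mesh
  -- error, `η` times the norm bound on the directions, at most `ε / 2 * ‖c‖`.
  refine ⟨n, r, min ε (ε / (2 * (n * (N * U) + 1))), hn, lt_min hε (by positivity), ?_⟩
  intro T _ hT hmesh δ c
  have hne : (pmfs n).Nonempty := ⟨_, single_mem_pmfs ⟨0, hn⟩⟩
  obtain ⟨f, hfix, hw, hz⟩ := exists_isProjFixedPt_update hne (isCompact_pmfs n) (convex_pmfs n) hT
    fun v => swapDirection u δ x r c v
  refine ⟨f, hfix, hw.mem_stdSimplex, fun v v' hv hv' =>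
    (hw.dist_lt hmesh hv hv').trans_le (min_le_left _ _), fun y _ => ?_⟩
  obtain ⟨k, hk⟩ := hnet y
  have hvert : ∀ v : T.vertices, (v : EuclideanSpace ℝ (Fin n)) ∈ pmfs n := fun v =>
    hT ▸ T.vertices_subset_space v.2
  have h1 := hw.sum_mul_inner_le hmesh
    (fun v => norm_swapDirection_le hU hU0 δ r c (v : EuclideanSpace ℝ (Fin n)))
    (hz _ (single_mem_pmfs k))
  have h2 : ∀ v : T.vertices, inner ℝ c (swapPayoff u δ x (discreteForecast r
      (v : EuclideanSpace ℝ (Fin n))) y) ≤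
      inner ℝ (swapDirection u δ x r c v)
        ((v : EuclideanSpace ℝ (Fin n)) - EuclideanSpace.single k 1) +
        N * (‖c‖ * (ε / (2 * (N + 1)))) := by
    intro v
    rw [inner_swapPayoff, inner_swapDirection u δ x r c (hvert v), ← sub_le_iff_le_add',
      ← Finset.sum_sub_distrib]
    refine (Finset.sum_le_card_nsmul _ _ (‖c‖ * (ε / (2 * (N + 1)))) fun a _ => ?_).trans_eq
      (by rw [nsmul_eq_mul, Finset.card_univ])
    rw [← mul_sub, sub_sub_sub_cancel_left]
    refine (le_abs_self _).trans ?_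
    rw [abs_mul]
    exact mul_le_mul (PiLp.norm_apply_le c _) (hk a) (abs_nonneg _) (norm_nonneg _)
  have h3 : inner ℝ c (randSwapPayoff u δ x r T (weight T f) y) ≤
      (∑ v : T.vertices, weight T f v * inner ℝ (swapDirection u δ x r c v)
        ((v : EuclideanSpace ℝ (Fin n)) - EuclideanSpace.single k 1)) +
        N * (‖c‖ * (ε / (2 * (N + 1)))) := by
    rw [randSwapPayoff, inner_sum]
    calc ∑ v : T.vertices, inner ℝ c (weight T f v • swapPayoff u δ x (discreteForecast r
          (v : EuclideanSpace ℝ (Fin n))) y)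
        ≤ ∑ v : T.vertices, weight T f v * (inner ℝ (swapDirection u δ x r c v)
            ((v : EuclideanSpace ℝ (Fin n)) - EuclideanSpace.single k 1) +
              N * (‖c‖ * (ε / (2 * (N + 1))))) := by
          refine Finset.sum_le_sum fun v _ => ?_
          rw [real_inner_smul_right]
          exact mul_le_mul_of_nonneg_left (h2 v) (hw.2.1 v)
      _ = _ := by
          simp only [mul_add]
          rw [Finset.sum_add_distrib, ← Finset.sum_mul, hw.2.2.1, one_mul]
  have h4 : N * (‖c‖ * (ε / (2 * (N + 1)))) ≤ ε / 2 * ‖c‖ := by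
    have : N / (N + 1) ≤ 1 := (div_le_one (by positivity)).2 (by linarith)
    calc N * (‖c‖ * (ε / (2 * (N + 1)))) = N / (N + 1) * (ε / 2 * ‖c‖) := by
          field_simp
      _ ≤ 1 * (ε / 2 * ‖c‖) := mul_le_mul_of_nonneg_right this (by positivity)
      _ = ε / 2 * ‖c‖ := one_mul _
  have h5 : min ε (ε / (2 * (n * (N * U) + 1))) * (n * (N * (‖c‖ * U))) ≤ ε / 2 * ‖c‖ := by
    have hq : (n * (N * U)) / (n * (N * U) + 1) ≤ 1 := (div_le_one (by positivity)).2 (by linarith)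
    calc min ε (ε / (2 * (n * (N * U) + 1))) * (n * (N * (‖c‖ * U)))
        ≤ ε / (2 * (n * (N * U) + 1)) * (n * (N * (‖c‖ * U))) :=
          mul_le_mul_of_nonneg_right (min_le_right _ _) (by positivity)
      _ = (n * (N * U)) / (n * (N * U) + 1) * (ε / 2 * ‖c‖) := by
          field_simp
      _ ≤ 1 * (ε / 2 * ‖c‖) := mul_le_mul_of_nonneg_right hq (by positivity)
      _ = ε / 2 * ‖c‖ := one_mul _
  linarith

end Calibration

end HalfSpace

/-! ### Assembly of the seven statements -/

open HalfSpace in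
theorem theorem2 :
    -- Adaptive conformal inference, randomized between adjacent points of a grid.
    (∀ (M : ℕ) (_ : 0 < M) (a : Fin (M + 1) → unitInterval) (_ : StrictMono a) (_ : a 0 = 0)
      (_ : a (Fin.last M) = 1) (β : ℝ) (_ : β ∈ Set.Icc (0 : ℝ) 1)
      (c : EuclideanSpace ℝ (Fin (M + 1))),
      ∃ p ∈ stdSimplex ℝ (Fin (M + 1)),
        (∃ i : Fin M, ∀ j, p j ≠ 0 → j = i.castSucc ∨ j = i.succ) ∧
        ∀ (S : Set ℝ) (Q : unitInterval → EReal), IsQuantileFn Q S →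
          (((∃ i, c i = 0) ∨ (∀ i, 0 < c i) ∨ (∀ i, c i < 0) ∨
              ∃ i : Fin M, 0 < c i.castSucc ∧ c i.succ < 0) →
            Solves (aciPayoff Q β a) S 0 c p) ∧
          (∀ ε : ℝ, 1 / (M : ℝ) < ε →
            ∀ y ∈ S, inner ℝ c (aciPayoff Q β a p y) ≤ ε * ∑ i, |c i|) ∧
          (∀ ε : ℝ, 1 / Real.sqrt (M + 1) ≤ ε → Solves (aciPayoff Q β a) S ε c p)) ∧
    -- Adaptive conformal inference, deterministic, with action set `[0, 1]`.
    (∀ (β : ℝ) (_ : β ∈ Set.Icc (0 : ℝ) 1) (c : unitInterval → ℝ) (_ : Continuous c),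
      ∃ a' : unitInterval,
        (c a' = 0 ∨ ((∀ a, 0 < c a) ∧ a' = 0) ∨ ((∀ a, c a < 0) ∧ a' = 1)) ∧
        ∀ (S : Set ℝ) (Q : unitInterval → EReal), IsQuantileFn Q S → ∀ y ∈ S,
          ∫ a, c a * (cover Q y a - β) ∂(Measure.dirac a') ≤ 0) ∧
    -- Quantile calibration at all levels in `[0, 1]`, by recalibration of a quantile function.
    (∀ (c : unitInterval → ℝ) (_ : Integrable c),
      ∃ τ : unitInterval, (Continuous c → τ = 0 ∨ τ = 1 ∨ c τ = 0) ∧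
        ∀ (S : Set ℝ) (Q : unitInterval → EReal), IsQuantileFn Q S → ∀ y ∈ S,
          ∫ a, c a * (cover (fun b => Q (stepRecal τ b)) y a - (a : ℝ)) ≤ 0) ∧
    -- Quantile calibration at finitely many levels, by a distribution forecast.
    (∀ (yMin yMax : ℝ) (L : Finset ℝ) (_ : ∀ q ∈ L, q ∈ Set.Icc (0 : ℝ) 1)
      (c : EuclideanSpace ℝ L),
      ∃ p : Measure ℝ, IsProbabilityMeasure p ∧ Continuous (ProbabilityTheory.cdf p) ∧
        Solves (quantilePayoff L) (Set.Icc yMin yMax) 0 c p) ∧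
    -- Moment-based calibration.
    (∀ (B ε : ℝ) (_ : 0 < B) (M : ℕ) (_ : 0 < M)
      (_ : Real.sqrt ((2 * B / M) ^ 2 + (B ^ 2 / M) ^ 2) < ε),
      (∃ T : Geometry.SimplicialComplex ℝ (EuclideanSpace ℝ (Fin 2)),
        T.space = momentBox B ∧ T.vertices = momentGrid B M ∧ MeshLT T ε) ∧
      ∀ (T : Geometry.SimplicialComplex ℝ (EuclideanSpace ℝ (Fin 2))) [Fintype T.vertices],
        T.space = momentBox B → MeshLT T ε →
          FixedPointOracle (momentBox B) T moments (Set.Icc (-B) B) ε) ∧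
    -- Discretized distribution calibration.
    (∀ (B ε : ℝ) (_ : 0 < B) (n : ℕ) (_ : 0 < n) (bin : ℝ → Fin n) (N : ℕ) (_ : 0 < N)
      (_ : Real.sqrt n / N < ε),
      (∃ T : Geometry.SimplicialComplex ℝ (EuclideanSpace ℝ (Fin n)),
        T.space = pmfs n ∧ T.vertices = pmfGrid n N ∧ MeshLT T ε) ∧
      ∀ (T : Geometry.SimplicialComplex ℝ (EuclideanSpace ℝ (Fin n))) [Fintype T.vertices],
        T.space = pmfs n → MeshLT T ε →
          FixedPointOracle (pmfs n) T (binIndicator bin) (Set.Icc (-B) B) ε) ∧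
    -- Decision calibration.
    (∀ (A X Y : Type*) [Fintype A] [Nonempty A] [MetricSpace Y] [CompactSpace Y] [Nonempty Y]
      [MeasurableSpace Y] [BorelSpace Y] (u : A → Y → X → ℝ) (x : X)
      (_ : ∀ a, Continuous fun y => u a y x),
      (∀ c : EuclideanSpace ℝ A, ∃ p : Measure Y, IsProbabilityMeasure p ∧
        Solves (actionPayoff u x) Set.univ 0 c p) ∧
      ∀ ε : ℝ, 0 < ε → ∃ (n : ℕ) (r : Fin n → Y) (η : ℝ), 0 < n ∧ 0 < η ∧
        ∀ (T : Geometry.SimplicialComplex ℝ (EuclideanSpace ℝ (Fin n))) [Fintype T.vertices],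
          T.space = pmfs n → MeshLT T η →
          ∀ (δ : Measure Y → X → A), IsBayesRule u δ → ∀ c : EuclideanSpace ℝ (A × A),
            ∃ f : EuclideanSpace ℝ (Fin n),
              IsProjFixedPt (pmfs n) (update T fun v => swapDirection u δ x r c v) f ∧
              weight T f ∈ stdSimplex ℝ T.vertices ∧
              (∀ v v' : T.vertices, weight T f v ≠ 0 → weight T f v' ≠ 0 →
                dist (v : EuclideanSpace ℝ (Fin n)) v' < ε) ∧
              Solves (randSwapPayoff u δ x r T) Set.univ ε c (weight T f)) := by
  refine ⟨fun M hM a ha h0 h1 β hβ c => exists_randomized_aci hM ha h0 h1 hβ c,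
    fun β hβ c hc => exists_deterministic_aci hβ hc, fun c hc => exists_stepRecal hc,
    fun yMin yMax L hL c => exists_distribution_forecast yMin yMax hL c, ?_, ?_, ?_⟩
  · intro B ε hB M hM hε
    refine ⟨exists_moment_triangulation hB hM hε, fun T _ hT hmesh => ?_⟩
    have hmem : ∀ y ∈ Set.Icc (-B) B, moments y ∈ momentBox B :=
      fun y hy => moments_mem_momentBox hy
    exact fixedPointOracle ⟨_, hmem B ⟨by linarith, le_rfl⟩⟩ (isCompact_momentBox B)
      (convex_momentBox B) hT hmem hmesh
  · intro B ε hB n hn bin N hN hε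
    refine ⟨exists_pmf_triangulation hn hN hε, fun T _ hT hmesh => ?_⟩
    exact fixedPointOracle ⟨_, single_mem_pmfs (bin 0)⟩ (isCompact_pmfs n) (convex_pmfs n) hT
      (fun y _ => single_mem_pmfs (bin y)) hmesh
  · intro A X Y _ _ _ _ _ _ _ u x hu
    refine ⟨fun c => exists_solves_actionPayoff hu c, fun ε hε => ?_⟩
    obtain ⟨n, r, η, hn, hη, h⟩ := exists_decision_oracle hu hε
    exact ⟨n, r, η, hn, hη, fun T _ hT hmesh δ _ c => h T hT hmesh δ c⟩
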